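/- For an integer $k\ge 3$ let $d_k(n)$ denote the number of ways of writing $n$ as an ordered product of $k$ positive integers, and for real $x>0$ put $$\Delta_k(x)=\sum_{n\le x} d_k(n)-\operatorname*{Res}_{s=1}\left(\frac{\zeta(s)^k x^s}{s}\right),$$ where $\zeta$ is the Riemann zeta-function. Let $k\ge 3$ be an integer, and let $\delta\ge 0$ be a real number such that, for every fixed $\eta>0$, $$\int_0^{\tau}\bigl|\zeta(\tfrac12+\delta+it)\bigr|^{2k}\,dt\ \ll_{\eta}\ \tau^{1+\eta}\qquad\text{as }\tau\to\infty. \tag{1}$$ Then for every $\varepsilon>0$ and all real numbers $X,h$ with $1\le h\le X/8$, $$\frac1X\int_X^{2X}\bigl(\Delta_k(x+h)-\Delta_k(x)\bigr)^2\,dx\ \ll\ h\,X^{2\delta+\varepsilon},$$ where the implied constant depends only on $k$, $\varepsilon$ and the implied constants $C(\eta)$ $(\eta>0)$ in (1); in particular it does not depend on $X$ or $h$. -/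

import Mathlib

noncomputable section

/-- The `k`-fold divisor function `d_k(n)`: the number of ways of writing `n` as an ordered product
of `k` positive integers. -/
def divisorFn (k n : ℕ) : ℕ := (Nat.finMulAntidiag k n).card

/-- The residue at `c` of a function that is holomorphic in a punctured neighbourhood of `c`:
`(2πi)⁻¹ ∮ f(s) ds` over a small positively oriented circle about `c`. (The integral does not
depend on the radius once the radius is small, so the limit is that of an eventually constant
function.) -/
def residue (f : ℂ → ℂ) (c : ℂ) : ℂ :=
  Filter.limUnder (nhdsWithin (0 : ℝ) (Set.Ioi 0)) fun r : ℝ =>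
    (2 * (Real.pi : ℂ) * Complex.I)⁻¹ * ∮ s in C(c, r), f s

/-- The main term `Res_{s = 1} ζ(s)^k x^s / s`. -/
def mainTerm (k : ℕ) (x : ℝ) : ℂ :=
  residue (fun s : ℂ => riemannZeta s ^ k * (x : ℂ) ^ s / s) 1

/-- `Δ_k(x) = ∑_{n ≤ x} d_k(n) - Res_{s = 1} ζ(s)^k x^s / s`, for `x > 0`; the residue is then a
real number. -/
def Delta (k : ℕ) (x : ℝ) : ℝ :=
  (∑ n ∈ Finset.Icc 1 ⌊x⌋₊, (divisorFn k n : ℝ)) - (mainTerm k x).re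

/-- `∫_0^τ |ζ(1/2 + δ + it)|^{2k} dt ≪_η τ^{1 + η}` as `τ → ∞`, for every fixed `η > 0`, where
`C η` is the implied constant. That the integral converges is part of the condition. -/
def ZetaMomentBound (k : ℕ) (δ : ℝ) (C : ℝ → ℝ) : Prop :=
  ∀ η : ℝ, 0 < η → ∀ᶠ τ : ℝ in Filter.atTop,
    IntervalIntegrable (fun t : ℝ => ‖riemannZeta (1 / 2 + δ + t * Complex.I)‖ ^ (2 * k))
      MeasureTheory.volume 0 τ ∧
    ∫ t in (0 : ℝ)..τ, ‖riemannZeta (1 / 2 + δ + t * Complex.I)‖ ^ (2 * k) ≤ C η * τ ^ (1 + η)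

end

/-! Put φ(u) = Δ_k(e^u) for u > 0 and φ(u) = 0 otherwise. By Abel summation the Laplace transform of
the summatory function of d_k is ζ(s)^k/s, and the transform of the residue term, cut off to u > 0,
is exactly the principal part of ζ(s)^k/s at s = 1. Hence for Re s > 2 the transform of φ is the
regular part E of that Laurent expansion (`integral_logDelta`). E is holomorphic of polynomial
growth in vertical strips inside Re s > 0.

The difference φ(u+θ) - φ(u) has transform (e^{θs} - 1)E(s). A Plancherel inequality with a shift of
the line (`lintegral_enorm_sq_le_of_laplace`) bounds its L² norm with weight e^{-2σu}, σ = 1/2 + δ,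
by the integral of |(e^{θs} - 1)E(s)|² on Re s = σ. There |sE(s)| ≪ |ζ(s)|^k + 1 and |e^{θs} -
1|/|s| ≪ 1/max(1/θ, |t|), so the moment hypothesis and partial summation give O(θ^{1-η})
(`lintegral_logDelta_shift_le`).

This controls the multiplicative differences Δ_k(x(1+l)) - Δ_k(x). Additive differences follow by
averaging over an auxiliary step (`lintegral_additive_difference_le`), in the manner of Saffari and
Vaughan.

Two points remain. The line σ = 1 meets the pole, but for all δ ≥ 1/2 the moment bound on a line
slightly to the right of 1, which holds unconditionally, is enough. Uniformity in δ < 1/2 comes from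
cutting [0, 1/2) into finitely many cells and using one admissible exponent per cell at a cost of
X^ε. -/

open scoped FourierTransform ENNReal Topology
open MeasureTheory Filter

/-! ### Plancherel, Gaussian inversion and shifts of vertical lines -/

/-- **Plancherel's theorem** for functions that are both integrable and square-integrable. -/
theorem eLpNorm_fourier_eq {f : ℝ → ℂ} (h1 : MeasureTheory.Integrable f)
    (h2 : MeasureTheory.MemLp f 2) :
    MeasureTheory.eLpNorm (𝓕 f) 2 = MeasureTheory.eLpNorm f 2 := by
  set F : MeasureTheory.Lp ℂ 2 (MeasureTheory.volume : MeasureTheory.Measure ℝ) := h2.toLp f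
  have hcont : Continuous (𝓕 f) :=
    VectorFourier.fourierIntegral_continuous Real.continuous_fourierChar
      (by exact continuous_inner) h1
  -- The isometry concerns the L² extension of the Fourier transform. It agrees almost everywhere
  -- with the integral transform because both give the same pairing with smooth compactly supported
  -- functions: in each pairing the transform can be moved onto the test function.
  have hae : ((𝓕 F : MeasureTheory.Lp ℂ 2 (MeasureTheory.volume : MeasureTheory.Measure ℝ)) :
      ℝ → ℂ) =ᵐ[MeasureTheory.volume] 𝓕 f := by
    apply ae_eq_of_integral_contDiff_smul_eq
    · exact (MeasureTheory.Lp.memLp _).locallyIntegrable (by norm_num)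
    · exact hcont.locallyIntegrable
    · intro g hg hgc
      have hgc' : HasCompactSupport (fun x => (g x : ℂ)) :=
        hgc.comp_left (g := ((↑) : ℝ → ℂ)) rfl
      set G : SchwartzMap ℝ ℂ := hgc'.toSchwartzMap (Complex.ofRealCLM.contDiff.comp hg)
      have hG : ∀ x, G x = (g x : ℂ) := fun _ => rfl
      have e1 := congrArg (fun T => T G)
        (MeasureTheory.Lp.fourier_toTemperedDistribution_eq F)
      simp only [TemperedDistribution.fourier_apply,
        MeasureTheory.Lp.toTemperedDistribution_apply] at e1
      have e2 : ∫ x, G x • ((𝓕 F : MeasureTheory.Lp ℂ 2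
          (MeasureTheory.volume : MeasureTheory.Measure ℝ)) : ℝ → ℂ) x
          = ∫ x, g x • ((𝓕 F : MeasureTheory.Lp ℂ 2
          (MeasureTheory.volume : MeasureTheory.Measure ℝ)) : ℝ → ℂ) x := by
        refine MeasureTheory.integral_congr_ae (.of_forall fun x => ?_)
        simp [hG]
      rw [← e2, ← e1]
      have e3 : ∫ x, (𝓕 G : SchwartzMap ℝ ℂ) x • (F : ℝ → ℂ) x
          = ∫ x, (𝓕 (G : ℝ → ℂ)) x • f x := by
        refine MeasureTheory.integral_congr_ae ?_
        filter_upwards [h2.coeFn_toLp] with x hx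
        rw [hx, SchwartzMap.fourier_coe]
      rw [e3]
      have e4 := VectorFourier.integral_fourierIntegral_smul_eq_flip (L := innerₗ ℝ)
        (μ := MeasureTheory.volume) (ν := MeasureTheory.volume)
        Real.continuous_fourierChar (by exact continuous_inner) (G.integrable) h1
      refine e4.trans ?_
      refine MeasureTheory.integral_congr_ae (.of_forall fun x => ?_)
      simp only [hG, flip_innerₗ]
      simp
      left
      rfl
  rw [← MeasureTheory.eLpNorm_congr_ae hae]
  have := MeasureTheory.Lp.norm_fourier_eq F
  rw [← MeasureTheory.eLpNorm_congr_ae h2.coeFn_toLp]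
  rw [MeasureTheory.Lp.norm_def, MeasureTheory.Lp.norm_def,
    ENNReal.toReal_eq_toReal_iff' (MeasureTheory.Lp.eLpNorm_ne_top _)
      (MeasureTheory.Lp.eLpNorm_ne_top _)] at this
  exact this

theorem lintegral_enorm_sq_fourierInv_eq {f : ℝ → ℂ} (h1 : MeasureTheory.Integrable f)
    (h2 : MeasureTheory.MemLp f 2) :
    ∫⁻ u, ‖𝓕⁻ f u‖ₑ ^ 2 = ∫⁻ u, ‖f u‖ₑ ^ 2 := by
  have h := eLpNorm_fourier_eq h1 h2
  simp only [MeasureTheory.eLpNorm_eq_lintegral_rpow_enorm_toReal (p := 2) (by norm_num)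
    (by norm_num)] at h
  have h' := congrArg (fun x : ℝ≥0∞ => x ^ (2 : ℝ)) h
  simp only [ENNReal.toReal_ofNat, ← ENNReal.rpow_mul] at h'
  norm_num at h'
  rw [← h', ← MeasureTheory.lintegral_neg_eq_self]
  simp [Real.fourierInv_eq_fourier_neg]

/-- Moving the transform from `f` onto the Gaussian turns the integral into an average of `f`
against an approximate identity at `u`. Integrability of `𝓕 f` is not needed, which matters because
φ has jumps. -/
theorem tendsto_integral_gaussian_mul_fourier {f : ℝ → ℂ} (hf : MeasureTheory.Integrable f)
    {u : ℝ} (hu : ContinuousAt f u) :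
    Filter.Tendsto (fun c : ℝ => ∫ w : ℝ, Complex.exp (-c⁻¹ * w ^ 2 + 2 * Real.pi * Complex.I *
      (u * w)) * 𝓕 f w) Filter.atTop (𝓝 (f u)) := by
  have A := Real.tendsto_integral_gaussian_smul' hf hu
  apply A.congr'
  filter_upwards [Filter.Ioi_mem_atTop 0] with c (hc : 0 < c)
  have J : MeasureTheory.Integrable (fun w : ℝ ↦ Complex.exp (- c⁻¹ * ‖w‖ ^ 2 +
      2 * Real.pi * Complex.I * inner ℝ u w)) :=
    GaussianFourier.integrable_cexp_neg_mul_sq_norm_add (by simpa) _ _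
  have := (VectorFourier.integral_fourierIntegral_smul_eq_flip (L := innerₗ ℝ)
      Real.continuous_fourierChar continuous_inner J hf)
  have e : ∀ w : ℝ, Complex.exp (-c⁻¹ * w ^ 2 + 2 * Real.pi * Complex.I * (u * w)) * 𝓕 f w =
      Complex.exp (- c⁻¹ * ‖w‖ ^ 2 + 2 * Real.pi * Complex.I * inner ℝ u w) •
      VectorFourier.fourierIntegral Real.fourierChar MeasureTheory.volume (innerₗ ℝ).flip f w := by
    intro w
    rw [smul_eq_mul, flip_innerₗ]
    congr 2
    · rw [← Complex.ofReal_pow ‖w‖, Real.norm_eq_abs, sq_abs]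
      simp
      ring
  simp only [e]
  rw [← this]
  congr with w
  change _ = (𝓕 (fun w : ℝ ↦ Complex.exp (- c⁻¹ * ‖w‖ ^ 2 +
      2 * Real.pi * Complex.I * inner ℝ u w))) w • f w
  rw [fourier_gaussian_innerProductSpace' (by simpa)]
  simp only [Complex.ofReal_inv, div_inv_eq_mul]
  congr 3
  simp
  ring

theorem exists_one_add_abs_pow_mul_exp_le (m : ℕ) {a : ℝ} (ha : 0 < a) :
    ∃ K : ℝ, 0 < K ∧ ∀ t : ℝ, (1 + |t|) ^ m * Real.exp (-a * t ^ 2) ≤ K := by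
  refine ⟨m.factorial * Real.exp (1 + 1 / (4 * a)), by positivity, fun t => ?_⟩
  have h1 : (1 + |t|) ^ m ≤ m.factorial * Real.exp (1 + |t|) := by
    have := Real.pow_div_factorial_le_exp (1 + |t|) (by positivity) m
    rwa [div_le_iff₀' (by positivity)] at this
  have h2 : |t| ≤ a * t ^ 2 + 1 / (4 * a) := by
    have h3 : 0 ≤ a * (|t| - 1 / (2 * a)) ^ 2 := by positivity
    have h4 : a * (|t| - 1 / (2 * a)) ^ 2 = a * t ^ 2 - |t| + 1 / (4 * a) := by
      rw [← sq_abs t]; field_simp; ring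
    linarith
  calc (1 + |t|) ^ m * Real.exp (-a * t ^ 2)
      ≤ m.factorial * Real.exp (1 + |t|) * Real.exp (-a * t ^ 2) := by gcongr
    _ = m.factorial * Real.exp (1 + |t| + -a * t ^ 2) := by rw [Real.exp_add (1 + |t|)]; ring
    _ ≤ _ := mul_le_mul_of_nonneg_left (Real.exp_le_exp.2 (by linarith)) (by positivity)

theorem integrable_of_norm_le_div_one_add_sq {f : ℝ → ℂ} (hf : Continuous f) {K : ℝ}
    (hK : ∀ t, ‖f t‖ ≤ K / (1 + t ^ 2)) : Integrable f := by
  refine (integrable_inv_one_add_sq.const_mul K).mono' hf.aestronglyMeasurable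
    (.of_forall fun t => ?_)
  simpa [div_eq_mul_inv] using hK t

theorem continuous_comp_verticalLine {H : ℂ → ℂ} {σ c x : ℝ} (hx : x ∈ Set.Icc σ c)
    (hd : ContinuousOn H (Complex.re ⁻¹' Set.Icc σ c)) :
    Continuous fun t : ℝ => H (x + t * Complex.I) :=
  hd.comp_continuous (by fun_prop) fun t => by simpa using hx

/-- Shifting the line of integration of a holomorphic function that decays in a vertical strip. -/
theorem integral_verticalLine_eq {H : ℂ → ℂ} {σ c K : ℝ} (hσ : σ ≤ c)
    (hd : DifferentiableOn ℂ H (Complex.re ⁻¹' Set.Icc σ c))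
    (hK : ∀ s : ℂ, s.re ∈ Set.Icc σ c → ‖H s‖ ≤ K / (1 + s.im ^ 2)) :
    ∫ t : ℝ, H (σ + t * Complex.I) = ∫ t : ℝ, H (c + t * Complex.I) := by
  have hint : ∀ x ∈ Set.Icc σ c, Integrable fun t : ℝ => H (x + t * Complex.I) := fun x hx =>
    integrable_of_norm_le_div_one_add_sq (continuous_comp_verticalLine hx hd.continuousOn)
      (K := K) fun t => by simpa using hK (x + t * Complex.I) (by simpa using hx)
  have hlim : ∀ x ∈ Set.Icc σ c, Tendsto (fun T : ℝ => ∫ t in (-T)..T, H (x + t * Complex.I))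
      atTop (𝓝 (∫ t : ℝ, H (x + t * Complex.I))) := fun x hx =>
    intervalIntegral_tendsto_integral (hint x hx) tendsto_neg_atTop_atBot tendsto_id
  have hhor : ∀ y : ℝ, ‖∫ x in σ..c, H (x + y * Complex.I)‖ ≤ K / (1 + y ^ 2) * |c - σ| := by
    intro y
    refine intervalIntegral.norm_integral_le_of_norm_le_const fun x hx => ?_
    rw [Set.uIoc_of_le hσ] at hx
    simpa using hK (x + y * Complex.I) (by simpa using ⟨hx.1.le, hx.2⟩)
  have hrect : ∀ T : ℝ, Complex.I * ((∫ t in (-T)..T, H (c + t * Complex.I)) -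
      ∫ t in (-T)..T, H (σ + t * Complex.I)) = (∫ x in σ..c, H (x + T * Complex.I)) -
      ∫ x in σ..c, H (x + (-T : ℝ) * Complex.I) := by
    intro T
    have := Complex.integral_boundary_rect_eq_zero_of_differentiableOn H
      (σ + (-T : ℝ) * Complex.I) (c + T * Complex.I) (hd.mono fun s hs => by
        have h1 := hs.1
        rw [Set.mem_preimage, Set.uIcc_of_le (by simpa using hσ)] at h1
        simpa using h1)
    simp at this ⊢
    linear_combination this
  have h0 : Tendsto (fun T : ℝ => (∫ x in σ..c, H (x + T * Complex.I)) -
      ∫ x in σ..c, H (x + (-T : ℝ) * Complex.I)) atTop (𝓝 0) := by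
    have hz : Tendsto (fun T : ℝ => 2 * (K / (1 + T ^ 2) * |c - σ|)) atTop (𝓝 0) := by
      have : Tendsto (fun T : ℝ => K / (1 + T ^ 2)) atTop (𝓝 0) :=
        tendsto_const_nhds.div_atTop (tendsto_atTop_add_const_left _ _
          (tendsto_pow_atTop two_ne_zero))
      simpa using (this.mul_const |c - σ|).const_mul 2
    refine squeeze_zero_norm (fun T => ?_) hz
    refine (norm_sub_le _ _).trans ?_
    have h1 := hhor T
    have h2 := hhor (-T)
    rw [neg_sq] at h2
    linarith
  have h1 := ((hlim c ⟨hσ, le_rfl⟩).sub (hlim σ ⟨le_rfl, hσ⟩)).const_mul Complex.I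
  simp_rw [hrect] at h1
  have h2 := tendsto_nhds_unique h1 h0
  have h3 := (mul_eq_zero.mp h2).resolve_left Complex.I_ne_zero
  exact (sub_eq_zero.mp h3).symm

/-- If `E` is holomorphic of polynomial growth in the strip `σ ≤ Re s ≤ c` and is the two-sided
Laplace transform of `φ` on the line `Re s = c`, then the `L²` norm of `φ(u) e^{-σu}` is bounded
by that of `E` on the line `Re s = σ`. -/
theorem lintegral_enorm_sq_le_of_laplace {φ : ℝ → ℂ} {E : ℂ → ℂ} {σ c B : ℝ} {m : ℕ}
    (hσ : σ ≤ c) (hint : Integrable fun u : ℝ => φ u * Complex.exp (-(c * u)))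
    (hE : ∀ t : ℝ, ∫ u : ℝ, φ u * Complex.exp (-((c + t * Complex.I) * u)) =
      E (c + t * Complex.I))
    (hd : DifferentiableOn ℂ E (Complex.re ⁻¹' Set.Icc σ c))
    (hB : ∀ s : ℂ, s.re ∈ Set.Icc σ c → ‖E s‖ ≤ B * (1 + |s.im|) ^ m)
    (hφ : ∀ᵐ u : ℝ, ContinuousAt φ u) :
    ∫⁻ u : ℝ, ‖φ u * Complex.exp (-(σ * u))‖ₑ ^ 2 ≤
      ∫⁻ w : ℝ, ‖E (σ + 2 * Real.pi * w * Complex.I)‖ₑ ^ 2 := by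
  have hB0 : 0 ≤ B := by
    have := (norm_nonneg _).trans (hB σ (by simpa using hσ))
    simpa using this
  set f : ℝ → ℂ := fun u => φ u * Complex.exp (-(c * u)) with hf
  have hFf : ∀ w : ℝ, 𝓕 f w = E (c + 2 * Real.pi * w * Complex.I) := by
    intro w
    rw [Real.fourier_real_eq_integral_exp_smul]
    have := hE (2 * Real.pi * w)
    push_cast at this
    rw [← this]
    refine integral_congr_ae (.of_forall fun u => ?_)
    simp only [hf, smul_eq_mul]
    rw [mul_left_comm, ← Complex.exp_add]
    congr 2
    push_cast
    ring
  -- the Gaussian weight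
  set W : ℕ → ℂ → ℂ := fun n s => Complex.exp ((s - c) ^ 2 / (4 * Real.pi ^ 2 * (n + 1 : ℝ)))
    with hW
  have hWnorm : ∀ (n : ℕ) (s : ℂ), ‖W n s‖ =
      Real.exp (((s.re - c) ^ 2 - s.im ^ 2) / (4 * Real.pi ^ 2 * (n + 1 : ℝ))) := by
    intro n s
    rw [hW, Complex.norm_exp]
    congr 1
    have : (s - c) ^ 2 / (4 * (Real.pi : ℂ) ^ 2 * (n + 1 : ℝ)) =
        (s - c) ^ 2 / ((4 * Real.pi ^ 2 * (n + 1 : ℝ) : ℝ) : ℂ) := by push_cast; rfl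
    rw [this, Complex.div_ofReal_re]
    congr 1
    simp [sq]
  -- The Gaussian decay in Im s absorbs the growth of degree `m`, with two more powers to spare for
  -- the factor 1/(1 + t²).
  have hWE : ∀ (n : ℕ), ∃ K : ℝ, 0 ≤ K ∧ ∀ s : ℂ, s.re ∈ Set.Icc σ c →
      ‖W n s * E s‖ ≤ K / (1 + s.im ^ 2) := by
    intro n
    set a : ℝ := 1 / (4 * Real.pi ^ 2 * (n + 1 : ℝ)) with ha
    have ha0 : 0 < a := by positivity
    obtain ⟨K, hK0, hK⟩ := exists_one_add_abs_pow_mul_exp_le (m + 2) ha0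
    refine ⟨Real.exp ((σ - c) ^ 2 * a) * (B * K), by positivity, fun s hs => ?_⟩
    rw [norm_mul, hWnorm, le_div_iff₀ (by positivity)]
    have e1 : ((s.re - c) ^ 2 - s.im ^ 2) / (4 * Real.pi ^ 2 * (n + 1 : ℝ)) =
        (s.re - c) ^ 2 * a + -a * s.im ^ 2 := by rw [ha]; ring
    rw [e1, Real.exp_add]
    have e2 : (s.re - c) ^ 2 ≤ (σ - c) ^ 2 := by nlinarith [hs.1, hs.2]
    have e3 : 1 + s.im ^ 2 ≤ (1 + |s.im|) ^ 2 := by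
      rw [← sq_abs s.im]; nlinarith [abs_nonneg s.im]
    calc Real.exp ((s.re - c) ^ 2 * a) * Real.exp (-a * s.im ^ 2) * ‖E s‖ * (1 + s.im ^ 2)
        ≤ Real.exp ((σ - c) ^ 2 * a) * Real.exp (-a * s.im ^ 2) * (B * (1 + |s.im|) ^ m) *
          (1 + |s.im|) ^ 2 := by
          gcongr
          exact hB s hs
      _ = Real.exp ((σ - c) ^ 2 * a) * (B * ((1 + |s.im|) ^ (m + 2) *
          Real.exp (-a * s.im ^ 2))) := by ring
      _ ≤ _ := by gcongr; exact hK _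
  have hWd : ∀ n, Differentiable ℂ (W n) := fun n => by simp only [hW]; fun_prop
  set F : ℕ → ℝ → ℂ := fun n w => W n (σ + 2 * Real.pi * w * Complex.I) *
    E (σ + 2 * Real.pi * w * Complex.I) with hF
  have hline : ∀ w : ℝ, ((σ : ℂ) + 2 * Real.pi * w * Complex.I) =
    σ + (2 * Real.pi * w : ℝ) * Complex.I := fun w => by push_cast; ring
  have hFc : ∀ n, Continuous (F n) := by
    intro n
    have := continuous_comp_verticalLine (H := fun s => W n s * E s) (x := σ) ⟨le_rfl, hσ⟩
      ((hWd n).continuous.continuousOn.mul hd.continuousOn)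
    have h2 := this.comp (g := fun t : ℝ => W n (σ + t * Complex.I) * E (σ + t * Complex.I))
      (f := fun w : ℝ => 2 * Real.pi * w) (by fun_prop)
    simp only [hF, hline]
    exact h2
  have hFbd : ∀ n, ∃ K : ℝ, 0 ≤ K ∧ ∀ w, ‖F n w‖ ≤ K / (1 + w ^ 2) := by
    intro n
    obtain ⟨K, hK0, hK⟩ := hWE n
    refine ⟨K, hK0, fun w => ?_⟩
    refine (hK _ (by simpa using hσ)).trans ?_
    have : w ^ 2 ≤ (2 * Real.pi * w) ^ 2 := by
      have := Real.pi_gt_three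
      have h1 : 1 ≤ (2 * Real.pi) ^ 2 := by nlinarith
      rw [mul_pow]
      nlinarith [sq_nonneg w]
    simp
    gcongr
  have hFint : ∀ n, Integrable (F n) := fun n => by
    obtain ⟨K, hK0, hK⟩ := hFbd n
    exact integrable_of_norm_le_div_one_add_sq (hFc n) hK
  have hF2 : ∀ n, MemLp (F n) 2 := fun n => by
    obtain ⟨K, hK0, hK⟩ := hFbd n
    refine (memLp_two_iff_integrable_sq_norm (hFc n).aestronglyMeasurable).2 ?_
    refine ((hFint n).norm.const_mul K).mono' (by have := hFc n; fun_prop) (.of_forall fun w => ?_)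
    have h1 : ‖F n w‖ ≤ K := (hK w).trans (div_le_self hK0 (by nlinarith [sq_nonneg w]))
    rw [Real.norm_of_nonneg (by positivity), sq]
    gcongr
  -- the inverse transform of the weighted function
  have hinv : ∀ (n : ℕ) (u : ℝ), 𝓕⁻ (F n) u = Complex.exp ((c - σ) * u) *
      ∫ w : ℝ, Complex.exp (-((n + 1 : ℝ)⁻¹ : ℝ) * w ^ 2 + 2 * Real.pi * Complex.I *
      (u * w)) * 𝓕 f w := by
    intro n u
    -- On Re s = c this is the integrand of Gaussian-regularised inversion for `f`, since (s - c)² =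
    -- -4π²w² there. On Re s = σ it is e^{(σ-c)u} times the integrand of `𝓕⁻ (F n)`. The contour
    -- shift identifies the two integrals.
    set H : ℂ → ℂ := fun s => Complex.exp ((s - c) * u) * (W n s * E s) with hH
    obtain ⟨K, hK0, hK⟩ := hWE n
    have hshift := integral_verticalLine_eq (H := H) (K := Real.exp (|σ - c| * |u|) * K) hσ
      (by
        refine DifferentiableOn.mul (by fun_prop) ?_
        exact (hWd n).differentiableOn.mul hd) (by
        intro s hs
        rw [hH, norm_mul, mul_div_assoc]
        gcongr
        · rw [Complex.norm_exp, Real.exp_le_exp]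
          simp only [Complex.mul_re, Complex.sub_re, Complex.ofReal_re, Complex.ofReal_im,
            mul_zero, sub_zero]
          refine (le_abs_self _).trans ?_
          rw [abs_mul]
          gcongr ?_ * _
          rw [abs_of_nonpos (by linarith [hs.2]), abs_of_nonpos (by linarith)]
          linarith [hs.1]
        · exact hK s hs)
    have hscale : ∀ x : ℝ, ∫ w : ℝ, H (x + 2 * Real.pi * w * Complex.I) =
        |(2 * Real.pi)⁻¹| • ∫ t : ℝ, H (x + t * Complex.I) := by
      intro x
      rw [← Measure.integral_comp_mul_left (fun t : ℝ => H (x + t * Complex.I))]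
      push_cast
      rfl
    have hshift' : ∫ w : ℝ, H (σ + 2 * Real.pi * w * Complex.I) =
        ∫ w : ℝ, H (c + 2 * Real.pi * w * Complex.I) := by
      rw [hscale, hscale, hshift]
    rw [Real.fourierInv_eq']
    have e1 : ∀ w : ℝ, Complex.exp (-((n + 1 : ℝ)⁻¹ : ℝ) * w ^ 2 + 2 * Real.pi * Complex.I *
        (u * w)) * 𝓕 f w = H (c + 2 * Real.pi * w * Complex.I) := by
      intro w
      rw [hFf]
      simp only [hH, hW]
      rw [← mul_assoc (Complex.exp _), ← Complex.exp_add]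
      congr 2
      have hn : ((n : ℂ) + 1) ≠ 0 := by exact_mod_cast n.succ_ne_zero
      have hpi : (Real.pi : ℂ) ≠ 0 := by exact_mod_cast Real.pi_ne_zero
      push_cast
      field_simp
      linear_combination (-(4 * (Real.pi : ℂ) ^ 2 * w ^ 2)) * Complex.I_sq
    simp only [e1]
    rw [← hshift', ← integral_const_mul]
    refine integral_congr_ae (.of_forall fun w => ?_)
    simp only [hH, hF, smul_eq_mul]
    rw [← mul_assoc (Complex.exp ((c - σ) * u)), ← Complex.exp_add]
    congr 2
    simp
    ring
  have hae : ∀ᵐ u : ℝ, ‖φ u * Complex.exp (-(σ * u))‖ₑ ^ 2 =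
      liminf (fun n => ‖𝓕⁻ (F n) u‖ₑ ^ 2) atTop := by
    filter_upwards [hφ] with u hu
    have hfc : ContinuousAt f u := hu.mul (by fun_prop)
    have h1 := (tendsto_integral_gaussian_mul_fourier hint hfc).comp
      (tendsto_atTop_add_const_right _ (1 : ℝ) tendsto_natCast_atTop_atTop)
    have h2 : Tendsto (fun n => 𝓕⁻ (F n) u) atTop (𝓝 (Complex.exp ((c - σ) * u) * f u)) := by
      simp only [hinv]
      exact h1.const_mul _
    have h3 : Complex.exp ((c - σ) * u) * f u = φ u * Complex.exp (-(σ * u)) := by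
      simp only [hf]
      rw [mul_left_comm, ← Complex.exp_add]
      congr 2
      ring
    rw [h3] at h2
    exact ((ENNReal.continuous_pow 2).continuousAt.tendsto.comp h2.enorm).liminf_eq.symm
  rw [lintegral_congr_ae hae]
  -- Fatou's lemma, then Plancherel for each `F n`. The weight on Re s = σ is at most
  -- exp((σ-c)²/(4π²(n+1))), which tends to 1, so nothing is lost in the limit.
  refine (lintegral_liminf_le' fun n => ?_).trans ?_
  · have : Continuous (𝓕⁻ (F n)) := by
      have h1 : Continuous (𝓕 (F n)) :=
        VectorFourier.fourierIntegral_continuous Real.continuous_fourierChar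
          (by exact continuous_inner) (hFint n)
      have h2 : 𝓕⁻ (F n) = fun u => 𝓕 (F n) (-u) := by
        ext u; rw [Real.fourierInv_eq_fourier_neg]
      rw [h2]
      fun_prop
    exact (this.enorm.measurable.pow_const 2).aemeasurable
  · have hle : ∀ n : ℕ, ∫⁻ u, ‖𝓕⁻ (F n) u‖ₑ ^ 2 ≤
        ENNReal.ofReal (Real.exp ((σ - c) ^ 2 / (4 * Real.pi ^ 2 * (n + 1 : ℝ)))) ^ 2 *
        ∫⁻ w : ℝ, ‖E (σ + 2 * Real.pi * w * Complex.I)‖ₑ ^ 2 := by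
      intro n
      rw [lintegral_enorm_sq_fourierInv_eq (hFint n) (hF2 n),
        ← lintegral_const_mul' _ _ (by simp)]
      refine lintegral_mono fun w => ?_
      rw [← mul_pow]
      gcongr
      simp only [hF, enorm_mul]
      gcongr
      rw [← ofReal_norm, hWnorm]
      gcongr
      simp
      positivity
    refine (liminf_le_liminf (.of_forall hle)).trans (le_of_eq ?_)
    have hlim : Tendsto (fun n : ℕ => ENNReal.ofReal (Real.exp ((σ - c) ^ 2 /
        (4 * Real.pi ^ 2 * (n + 1 : ℝ)))) ^ 2) atTop (𝓝 1) := by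
      have h1 : Tendsto (fun n : ℕ => (σ - c) ^ 2 / (4 * Real.pi ^ 2 * (n + 1 : ℝ))) atTop
          (𝓝 0) :=
        tendsto_const_nhds.div_atTop (Tendsto.const_mul_atTop (by positivity)
          (tendsto_atTop_add_const_right _ (1 : ℝ) tendsto_natCast_atTop_atTop))
      have h2 := (ENNReal.continuous_pow 2).continuousAt.tendsto.comp
        ((ENNReal.continuous_ofReal.tendsto _).comp ((Real.continuous_exp.tendsto _).comp h1))
      simpa [Function.comp_def] using h2
    have := ENNReal.Tendsto.mul_const (b := ∫⁻ w : ℝ, ‖E (σ + 2 * Real.pi * w *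
      Complex.I)‖ₑ ^ 2) hlim (Or.inl one_ne_zero)
    rw [one_mul] at this
    exact this.liminf_eq

/-! ### Continuation and growth of ζ in Re s > 0 -/

/-- The fractional part function, cut off to `t > 1`. -/
noncomputable def fractCutoff (t : ℝ) : ℂ := (Set.Ioi 1).indicator (fun t => ((Int.fract t : ℝ) : ℂ)) t

theorem norm_fractCutoff_le (t : ℝ) : ‖fractCutoff t‖ ≤ 1 := by
  unfold fractCutoff
  by_cases ht : t ∈ Set.Ioi (1 : ℝ)
  · rw [Set.indicator_of_mem ht, Complex.norm_real, Real.norm_of_nonneg (Int.fract_nonneg t)]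
    exact (Int.fract_lt_one t).le
  · rw [Set.indicator_of_notMem ht]; simp

theorem measurable_fractCutoff : Measurable fractCutoff :=
  (Complex.measurable_ofReal.comp measurable_fract).indicator measurableSet_Ioi

theorem fractCutoff_isBigO_atTop : fractCutoff =O[atTop] fun t : ℝ => t ^ (-(0 : ℝ)) := by
  refine Asymptotics.IsBigO.of_bound 1 (.of_forall fun t => ?_)
  simpa using norm_fractCutoff_le t

theorem fractCutoff_isBigO_zero (b : ℝ) : fractCutoff =O[𝓝[>] 0] fun t : ℝ => t ^ (-b) := by
  refine Asymptotics.IsBigO.of_bound 1 ?_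
  filter_upwards [Ioo_mem_nhdsGT (zero_lt_one' ℝ)] with t ht
  unfold fractCutoff
  rw [Set.indicator_of_notMem (by simpa using ht.2.le)]
  simp

theorem locallyIntegrable_fractCutoff : LocallyIntegrableOn fractCutoff (Set.Ioi 0) := by
  refine LocallyIntegrable.locallyIntegrableOn ?_ _
  refine (locallyIntegrable_const (1 : ℝ)).mono measurable_fractCutoff.aestronglyMeasurable
    (.of_forall fun t => ?_)
  simpa using norm_fractCutoff_le t

theorem differentiableAt_mellin_fractCutoff {s : ℂ} (hs : 0 < s.re) :
    DifferentiableAt ℂ (mellin fractCutoff) (-s) :=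
  mellin_differentiableAt_of_isBigO_rpow locallyIntegrable_fractCutoff fractCutoff_isBigO_atTop
    (by simpa using hs) (fractCutoff_isBigO_zero (-s.re - 1)) (by simp)

theorem mellin_fractCutoff (s : ℂ) : mellin fractCutoff (-s) =
    ∫ t in Set.Ioi (1 : ℝ), ((Int.fract t : ℝ) : ℂ) * (t : ℂ) ^ (-(s + 1)) := by
  have : ∀ t : ℝ, (t : ℂ) ^ (-s - 1) • fractCutoff t =
      (Set.Ioi (1 : ℝ)).indicator (fun t : ℝ => ((Int.fract t : ℝ) : ℂ) * (t : ℂ) ^ (-(s + 1))) t := by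
    intro t
    unfold fractCutoff
    by_cases ht : t ∈ Set.Ioi (1 : ℝ)
    · rw [Set.indicator_of_mem ht, Set.indicator_of_mem ht, smul_eq_mul, mul_comm]
      congr 2
      ring
    · rw [Set.indicator_of_notMem ht, Set.indicator_of_notMem ht, smul_zero]
  rw [mellin]
  simp only [this]
  rw [setIntegral_indicator measurableSet_Ioi, Set.inter_eq_right.2 (Set.Ioi_subset_Ioi zero_le_one)]

theorem integrableOn_fract_mul_cpow {s : ℂ} (hs : 0 < s.re) :
    IntegrableOn (fun t : ℝ => ((Int.fract t : ℝ) : ℂ) * (t : ℂ) ^ (-(s + 1))) (Set.Ioi 1) := by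
  have h1 : IntegrableOn (fun t : ℝ => t ^ (-s.re - 1)) (Set.Ioi 1) :=
    integrableOn_Ioi_rpow_of_lt (by linarith) one_pos
  refine h1.mono' ?_ ?_
  · refine ((Complex.measurable_ofReal.comp measurable_fract).aestronglyMeasurable).mul ?_
    refine ContinuousOn.aestronglyMeasurable (fun t ht => ?_) measurableSet_Ioi
    refine ContinuousAt.continuousWithinAt ?_
    refine ContinuousAt.cpow (by fun_prop) (by fun_prop) (Or.inl ?_)
    exact zero_lt_one.trans ht
  · refine (ae_restrict_iff' measurableSet_Ioi).2 (.of_forall fun t ht => ?_)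
    rw [norm_mul, Complex.norm_real, Real.norm_of_nonneg (Int.fract_nonneg t),
      Complex.norm_cpow_eq_rpow_re_of_pos (zero_lt_one.trans ht)]
    have h2 : (-(s + 1)).re = -s.re - 1 := by simp; ring
    rw [h2]
    exact mul_le_of_le_one_left (Real.rpow_nonneg (zero_lt_one.trans ht).le _)
      (Int.fract_lt_one t).le

theorem norm_mellin_fractCutoff_le {s : ℂ} (hs : 0 < s.re) :
    ‖mellin fractCutoff (-s)‖ ≤ 1 / s.re := by
  rw [mellin_fractCutoff]
  have h1 : IntegrableOn (fun t : ℝ => t ^ (-s.re - 1)) (Set.Ioi 1) :=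
    integrableOn_Ioi_rpow_of_lt (by linarith) one_pos
  refine (norm_integral_le_of_norm_le h1 ?_).trans (le_of_eq ?_)
  · refine (ae_restrict_iff' measurableSet_Ioi).2 (.of_forall fun t ht => ?_)
    rw [norm_mul, Complex.norm_real, Real.norm_of_nonneg (Int.fract_nonneg t),
      Complex.norm_cpow_eq_rpow_re_of_pos (zero_lt_one.trans ht)]
    have h2 : (-(s + 1)).re = -s.re - 1 := by simp; ring
    rw [h2]
    exact mul_le_of_le_one_left (Real.rpow_nonneg (zero_lt_one.trans ht).le _)
      (Int.fract_lt_one t).le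
  · rw [integral_Ioi_rpow_of_lt (by linarith) one_pos, Real.one_rpow]
    rw [sub_add_cancel, neg_div_neg_eq]

/-- Abel summation for ∑ n^{-s} with ⌊t⌋ = t - {t}: the term t integrates to the pole, and {t} gives
a Mellin transform that still converges for Re s > 0. -/
theorem riemannZeta_eq_of_one_lt_re {s : ℂ} (hs : 1 < s.re) :
    riemannZeta s = s / (s - 1) - s * mellin fractCutoff (-s) := by
  have h1 := LSeries_eq_mul_integral_of_nonneg (fun _ => 1) zero_le_one hs (by
    simpa using Asymptotics.isBigO_refl (fun n : ℕ => (n : ℝ)) atTop) (fun _ => zero_le_one)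
  have h2 : LSeries (fun _ => ((1 : ℝ) : ℂ)) s = riemannZeta s := by
    rw [← LSeries_one_eq_riemannZeta hs]
    congr 1
  rw [h2] at h1
  have hs1 : s - 1 ≠ 0 := fun h => by
    have := congrArg Complex.re h
    simp at this
    linarith
  have h3 : ∀ t ∈ Set.Ioi (1 : ℝ), (∑ k ∈ Finset.Icc 1 ⌊t⌋₊, ((1 : ℝ) : ℂ)) *
      (t : ℂ) ^ (-(s + 1)) = (t : ℂ) ^ (-s) - ((Int.fract t : ℝ) : ℂ) * (t : ℂ) ^ (-(s + 1)) := by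
    intro t ht
    have ht0 : 0 < t := zero_lt_one.trans ht
    have e1 : (t : ℂ) ^ (-s) = t * (t : ℂ) ^ (-(s + 1)) := by
      rw [neg_add, Complex.cpow_add _ _ (by exact_mod_cast ht0.ne'), Complex.cpow_neg_one]
      have : (t : ℂ) ≠ 0 := by exact_mod_cast ht0.ne'
      field_simp
    have e2 : (∑ k ∈ Finset.Icc 1 ⌊t⌋₊, ((1 : ℝ) : ℂ)) = t - ((Int.fract t : ℝ) : ℂ) := by
      rw [← Complex.ofReal_sub, Int.self_sub_fract]
      simp only [Complex.ofReal_one, Finset.sum_const, Nat.card_Icc, add_tsub_cancel_right,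
        nsmul_eq_mul, mul_one]
      have := natCast_floor_eq_intCast_floor (R := ℝ) (a := t) ht0.le
      exact_mod_cast congrArg (fun x : ℝ => (x : ℂ)) this
    rw [e1, e2]
    ring
  rw [setIntegral_congr_fun measurableSet_Ioi h3, integral_sub, ← mellin_fractCutoff,
    integral_Ioi_cpow_of_lt] at h1
  · rw [h1, mul_sub]
    congr 1
    simp only [Complex.ofReal_one, Complex.one_cpow]
    have : -s + 1 ≠ 0 := fun h => hs1 (by linear_combination -h)
    field_simp
    ring
  · simpa using hs
  · exact one_pos
  · exact integrableOn_Ioi_cpow_of_lt (by simpa using hs) one_pos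
  · exact integrableOn_fract_mul_cpow (by linarith)

theorem isOpen_re_pos : IsOpen {s : ℂ | 0 < s.re} :=
  isOpen_lt continuous_const Complex.continuous_re

/-- Both sides are holomorphic in the half-plane Re s > 0 and agree for Re s > 1, so the identity
theorem applies. Multiplying by s - 1 removes the pole, so s = 1 needs no separate treatment. -/
theorem riemannZeta₁_eq {s : ℂ} (hs : 0 < s.re) :
    riemannZeta₁ s = s - s * (s - 1) * mellin fractCutoff (-s) := by
  have hd : DifferentiableOn ℂ (fun s => s - s * (s - 1) * mellin fractCutoff (-s))
      {s : ℂ | 0 < s.re} := by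
    intro s hs
    refine DifferentiableAt.differentiableWithinAt ?_
    have := (differentiableAt_mellin_fractCutoff hs).comp s differentiableAt_id.neg
    simp only [Function.comp_def] at this
    exact differentiableAt_id.sub ((by fun_prop : DifferentiableAt ℂ (fun s : ℂ => s * (s - 1)) s).mul
      this)
  have hconn : IsPreconnected {s : ℂ | 0 < s.re} :=
    (convex_halfSpace_re_gt 0).isPreconnected
  refine (differentiable_riemannZeta₁.differentiableOn.analyticOnNhd
    isOpen_re_pos).eqOn_of_preconnected_of_eventuallyEq (hd.analyticOnNhd isOpen_re_pos) hconn
    (z₀ := 2) (by simp) ?_ hs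
  filter_upwards [(isOpen_lt continuous_const Complex.continuous_re :
    IsOpen {s : ℂ | 1 < s.re}).mem_nhds (by simp : (1 : ℝ) < (2 : ℂ).re)] with s hs
  have hs1 : s - 1 ≠ 0 := fun h => by
    have := congrArg Complex.re h
    simp at this
    have : (1 : ℝ) < s.re := hs
    linarith
  have h1 := riemannZeta_eq_inv_sub_mul (sub_ne_zero.1 hs1)
  rw [riemannZeta_eq_of_one_lt_re hs] at h1
  field_simp at h1
  rw [← h1]
  ring

theorem norm_riemannZeta₁_le {s : ℂ} (hs : 0 < s.re) :
    ‖riemannZeta₁ s‖ ≤ ‖s‖ + ‖s‖ * ‖s - 1‖ / s.re := by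
  rw [riemannZeta₁_eq hs]
  refine (norm_sub_le _ _).trans ?_
  gcongr
  rw [norm_mul, norm_mul, div_eq_mul_one_div]
  gcongr
  exact norm_mellin_fractCutoff_le hs

/-! ### Laurent expansion of ζ(s)^k/s at 1 and growth of its regular part -/

/-- Taylor expansion with holomorphic remainder. -/
theorem exists_taylor_remainder {q : ℂ → ℂ} {U : Set ℂ} {c : ℂ} (hU : U ∈ 𝓝 c)
    (hq : DifferentiableOn ℂ q U) (k : ℕ) :
    ∃ (a : ℕ → ℂ) (E : ℂ → ℂ), DifferentiableOn ℂ E U ∧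
      ∀ s, q s = ∑ i ∈ Finset.range k, a i * (s - c) ^ i + (s - c) ^ k * E s := by
  induction k with
  | zero => exact ⟨0, q, hq, fun s => by simp⟩
  | succ k ih =>
    obtain ⟨a, E, hE, h⟩ := ih
    -- The next coefficient is the value at `c` of the current remainder, and `dslope` divides out
    -- one more factor s - c with the singularity removed.
    refine ⟨fun i => if i = k then E c else a i, dslope E c,
      (Complex.differentiableOn_dslope hU).2 hE, fun s => ?_⟩
    simp only [h s, Finset.sum_range_succ, if_true]
    have h1 : ∑ i ∈ Finset.range k, (if i = k then E c else a i) * (s - c) ^ i =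
        ∑ i ∈ Finset.range k, a i * (s - c) ^ i :=
      Finset.sum_congr rfl fun i hi => by rw [if_neg (Finset.mem_range.1 hi).ne]
    rw [h1]
    have h2 := sub_smul_dslope E c s
    rw [smul_eq_mul] at h2
    rw [pow_succ]
    linear_combination (s - c) ^ k * (-h2)

/-- Taylor expansion of ((s-1)ζ(s))^k/s to order k, divided by (s-1)^k. One function `E` serves both
identities: the first gives its growth, the second isolates the principal part. -/
theorem exists_zeta_pow_expansion (k : ℕ) :
    ∃ (a : ℕ → ℂ) (E : ℂ → ℂ), DifferentiableOn ℂ E {s : ℂ | 0 < s.re} ∧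
      (∀ s, riemannZeta₁ s ^ k / s =
        ∑ i ∈ Finset.range k, a i * (s - 1) ^ i + (s - 1) ^ k * E s) ∧
      ∀ s, s ≠ 1 → riemannZeta s ^ k / s =
        ∑ i ∈ Finset.range k, a i / (s - 1) ^ (k - i) + E s := by
  have hq : DifferentiableOn ℂ (fun s => riemannZeta₁ s ^ k / s) {s : ℂ | 0 < s.re} := by
    intro s hs
    have hs0 : s ≠ 0 := fun h => by simp [h] at hs
    exact (((differentiable_riemannZeta₁ s).pow k).div differentiableAt_id
      hs0).differentiableWithinAt
  obtain ⟨a, E, hE, h⟩ := exists_taylor_remainder (c := 1)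
    (isOpen_re_pos.mem_nhds (by simp)) hq k
  refine ⟨a, E, hE, h, fun s hs => ?_⟩
  have hs1 : s - 1 ≠ 0 := sub_ne_zero.2 hs
  rw [riemannZeta_eq_inv_sub_mul hs, mul_pow, mul_div_assoc, h s, mul_add, Finset.mul_sum, inv_pow,
    inv_mul_cancel_left₀ (pow_ne_zero k hs1)]
  congr 1
  refine Finset.sum_congr rfl fun i hi => ?_
  have hik : k = (k - i) + i := by have := Finset.mem_range.1 hi; omega
  conv_lhs => rw [hik, pow_add]
  field_simp

/-- For |Im s| ≤ 1 compactness suffices. Beyond that |s - 1| ≥ 1, so dividing the Taylor identity by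
(s-1)^k is harmless; the exponent 2k comes from (s-1)ζ(s) ≪ (1+|t|)². Any polynomial bound would do,
as the shift of the line uses a Gaussian weight. -/
theorem norm_remainder_le {k : ℕ} {a : ℕ → ℂ} {E : ℂ → ℂ}
    (hE : DifferentiableOn ℂ E {s : ℂ | 0 < s.re})
    (h : ∀ s, riemannZeta₁ s ^ k / s =
        ∑ i ∈ Finset.range k, a i * (s - 1) ^ i + (s - 1) ^ k * E s)
    {σ c : ℝ} (hσ : 0 < σ) :
    ∃ B : ℝ, 0 ≤ B ∧ ∀ s : ℂ, s.re ∈ Set.Icc σ c → ‖E s‖ ≤ B * (1 + |s.im|) ^ (2 * k) := by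
  have hcpt : IsCompact (Set.Icc σ c ×ℂ Set.Icc (-1) 1) := isCompact_Icc.reProdIm isCompact_Icc
  obtain ⟨B1, hB1⟩ := hcpt.exists_bound_of_continuousOn (f := E)
    (hE.continuousOn.mono fun s hs => hσ.trans_le hs.1.1)
  set D : ℝ := 1 + |c| with hD
  set A : ℝ := D + D * (D + 1) / σ with hA
  have hA0 : 0 ≤ A := by positivity
  refine ⟨|B1| + (A ^ k / σ + ∑ i ∈ Finset.range k, ‖a i‖), by positivity, fun s hs => ?_⟩
  have hpow : (1 : ℝ) ≤ (1 + |s.im|) ^ (2 * k) := one_le_pow₀ (by simp)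
  by_cases him : |s.im| ≤ 1
  · have h1 := hB1 s ⟨hs, abs_le.1 him⟩
    calc ‖E s‖ ≤ |B1| := h1.trans (le_abs_self _)
      _ ≤ |B1| + (A ^ k / σ + ∑ i ∈ Finset.range k, ‖a i‖) :=
        le_add_of_nonneg_right (by positivity)
      _ ≤ _ := le_mul_of_one_le_right (by positivity) hpow
  · push Not at him
    have hs0 : 0 < s.re := hσ.trans_le hs.1
    have hn1 : 1 ≤ ‖s - 1‖ := by
      have := Complex.abs_im_le_norm (s - 1)
      simp at this
      linarith
    have hsσ : σ ≤ ‖s‖ := hs.1.trans ((le_abs_self _).trans (Complex.abs_re_le_norm s))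
    have hsn : ‖s‖ ≤ D * (1 + |s.im|) := by
      have h1 := Complex.norm_le_abs_re_add_abs_im s
      have h2 : |s.re| ≤ |c| := by
        rw [abs_of_pos hs0]; exact hs.2.trans (le_abs_self c)
      have h3 : 0 ≤ |c| * |s.im| := by positivity
      rw [hD]
      nlinarith [abs_nonneg s.im]
    have hsn1 : ‖s - 1‖ ≤ (D + 1) * (1 + |s.im|) := by
      have h1 := norm_sub_le s 1
      rw [norm_one] at h1
      nlinarith [abs_nonneg s.im]
    have hz : ‖riemannZeta₁ s‖ ≤ A * (1 + |s.im|) ^ 2 := by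
      refine (norm_riemannZeta₁_le hs0).trans ?_
      have hD0 : 0 ≤ D := by positivity
      have e1 : ‖s‖ * ‖s - 1‖ / s.re ≤ D * (1 + |s.im|) * ((D + 1) * (1 + |s.im|)) / σ := by
        gcongr
        exact hs.1
      have e2 : D * (1 + |s.im|) ≤ D * (1 + |s.im|) ^ 2 := by
        gcongr
        exact le_self_pow₀ (by simp) (by norm_num)
      calc _ ≤ D * (1 + |s.im|) ^ 2 + D * (1 + |s.im|) * ((D + 1) * (1 + |s.im|)) / σ := by
            linarith
        _ = _ := by rw [hA]; ring
    have hEs : E s = ((riemannZeta₁ s ^ k / s) - ∑ i ∈ Finset.range k, a i * (s - 1) ^ i) /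
        (s - 1) ^ k := by
      have : s - 1 ≠ 0 := fun h0 => by rw [h0, norm_zero] at hn1; linarith
      rw [h s]
      field_simp
      ring
    have hk1 : 1 ≤ ‖s - 1‖ ^ k := one_le_pow₀ hn1
    calc ‖E s‖ ≤ (‖riemannZeta₁ s ^ k / s‖ + ∑ i ∈ Finset.range k, ‖a i‖ * ‖s - 1‖ ^ k) /
          ‖s - 1‖ ^ k := by
          rw [hEs, norm_div, norm_pow]
          gcongr
          refine (norm_sub_le _ _).trans ?_
          gcongr
          refine (norm_sum_le _ _).trans (Finset.sum_le_sum fun i hi => ?_)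
          rw [norm_mul, norm_pow]
          gcongr
          exact (Finset.mem_range.1 hi).le
      _ = ‖riemannZeta₁ s ^ k / s‖ / ‖s - 1‖ ^ k + ∑ i ∈ Finset.range k, ‖a i‖ := by
          rw [← Finset.sum_mul]
          field_simp
      _ ≤ (A * (1 + |s.im|) ^ 2) ^ k / σ + ∑ i ∈ Finset.range k, ‖a i‖ := by
          refine add_le_add_left ((div_le_self (norm_nonneg _) hk1).trans ?_) _
          rw [norm_div, norm_pow]
          gcongr
      _ = A ^ k / σ * (1 + |s.im|) ^ (2 * k) + ∑ i ∈ Finset.range k, ‖a i‖ := by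
          rw [mul_pow, ← pow_mul]; ring
      _ ≤ A ^ k / σ * (1 + |s.im|) ^ (2 * k) + (∑ i ∈ Finset.range k, ‖a i‖) *
          (1 + |s.im|) ^ (2 * k) := by
          gcongr
          exact le_mul_of_one_le_right (by positivity) hpow
      _ ≤ _ := by
          rw [← add_mul]
          refine mul_le_mul_of_nonneg_right ?_ (by positivity)
          exact le_add_of_nonneg_left (abs_nonneg _)

/-! ### The divisor function d_k and its Laplace transform -/

section

open scoped LSeries.notation

theorem divisorFn_zero (n : ℕ) : divisorFn 0 n = if n = 1 then 1 else 0 := by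
  unfold divisorFn
  split_ifs with h
  · rw [h, Nat.finMulAntidiag_one, Finset.card_singleton]
  · rw [Nat.finMulAntidiag_zero_left h, Finset.card_empty]

/-- Fibre the factorisations over their first factor. This exhibits d_{k+1} as the Dirichlet
convolution of 1 with d_k. -/
theorem divisorFn_succ (k n : ℕ) :
    divisorFn (k + 1) n = ∑ p ∈ n.divisorsAntidiagonal, divisorFn k p.2 := by
  rcases eq_or_ne n 0 with rfl | hn
  · simp [divisorFn]
  unfold divisorFn
  rw [Finset.card_eq_sum_card_fiberwise (f := fun f : Fin (k + 1) → ℕ =>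
    (f 0, ∏ i, Fin.tail f i)) (t := n.divisorsAntidiagonal)]
  · refine Finset.sum_congr rfl fun p hp => ?_
    rw [Nat.mem_divisorsAntidiagonal] at hp
    refine Finset.card_nbij' (fun f => Fin.tail f) (fun g => Fin.cons p.1 g) ?_ ?_ ?_ ?_
    · intro f hf
      simp only [Finset.coe_filter, Nat.mem_finMulAntidiag, Set.mem_ofPred_eq] at hf
      simp only [Finset.mem_coe, Nat.mem_finMulAntidiag]
      refine ⟨by rw [← hf.2], fun h => hn ?_⟩
      rw [← hp.1, h, mul_zero]
    · intro g hg
      simp only [Finset.mem_coe, Nat.mem_finMulAntidiag] at hg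
      simp only [Finset.coe_filter, Nat.mem_finMulAntidiag, Set.mem_ofPred_eq, Fin.tail_cons,
        Fin.cons_zero, hg.1, Prod.mk.eta, and_true]
      rw [Fin.prod_cons, hg.1]
      exact hp
    · intro f hf
      simp only [Finset.coe_filter, Set.mem_ofPred_eq] at hf
      rw [← hf.2]
      simp
    · intro g hg
      simp
  · intro f hf
    simp only [Finset.mem_coe, Nat.mem_finMulAntidiag, Nat.mem_divisorsAntidiagonal] at hf ⊢
    rw [Fin.prod_univ_succ] at hf
    exact hf

theorem LSeriesHasSum_divisorFn (k : ℕ) {s : ℂ} (hs : 1 < s.re) :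
    LSeriesHasSum (fun n => (divisorFn k n : ℂ)) s (riemannZeta s ^ k) := by
  induction k with
  | zero =>
    have h : (fun n => (divisorFn 0 n : ℂ)) = LSeries.delta := by
      ext n
      rw [divisorFn_zero, LSeries.delta]
      split_ifs <;> simp
    have e : LSeries.term LSeries.delta s = fun n => if n = 1 then 1 else 0 := by
      ext n
      rw [LSeries.term_delta]
    rw [h, LSeriesHasSum, e, pow_zero]
    exact hasSum_ite_eq 1 1
  | succ k ih =>
    have h : (fun n => (divisorFn (k + 1) n : ℂ)) =
        LSeries.convolution 1 (fun n => (divisorFn k n : ℂ)) := by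
      rw [LSeries.convolution_def]
      ext n
      rw [divisorFn_succ]
      simp
    rw [h, pow_succ']
    exact (LSeriesHasSum_one hs).convolution ih

/-- The summatory function of `d_k`. -/
noncomputable def divisorSum (k : ℕ) (x : ℝ) : ℝ :=
  ∑ n ∈ Finset.Icc 1 ⌊x⌋₊, (divisorFn k n : ℝ)

theorem divisorSum_nonneg (k : ℕ) (x : ℝ) : 0 ≤ divisorSum k x :=
  Finset.sum_nonneg fun _ _ => Nat.cast_nonneg _

theorem monotone_divisorSum (k : ℕ) : Monotone (divisorSum k) := by
  intro x y hxy
  refine Finset.sum_le_sum_of_subset_of_nonneg ?_ fun _ _ _ => Nat.cast_nonneg _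
  exact Finset.Icc_subset_Icc le_rfl (Nat.floor_le_floor hxy)

/-- Rankin's trick: d_k(n) ≤ x² d_k(n)/n² for n ≤ x, and ∑ d_k(n)/n² converges. This crude exponent
is why transforms are first computed for Re s > 2. -/
theorem exists_divisorSum_le (k : ℕ) :
    ∃ C : ℝ, 0 ≤ C ∧ ∀ x : ℝ, 0 ≤ x → divisorSum k x ≤ C * x ^ 2 := by
  have hsum : Summable fun n : ℕ => (divisorFn k n : ℝ) / (n : ℝ) ^ 2 := by
    have h1 := (LSeriesHasSum_divisorFn k (s := 2) (by simp)).LSeriesSummable.norm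
    refine h1.congr fun n => ?_
    rw [LSeries.norm_term_eq]
    split_ifs with h
    · simp [h]
    · simp
  refine ⟨∑' n : ℕ, (divisorFn k n : ℝ) / (n : ℝ) ^ 2, tsum_nonneg fun n => by positivity,
    fun x hx => ?_⟩
  have h2 : divisorSum k x ≤
      (∑ n ∈ Finset.Icc 1 ⌊x⌋₊, (divisorFn k n : ℝ) / (n : ℝ) ^ 2) * x ^ 2 := by
    rw [divisorSum, Finset.sum_mul]
    refine Finset.sum_le_sum fun n hn => ?_
    rw [Finset.mem_Icc] at hn
    have hn0 : (0 : ℝ) < n := by exact_mod_cast hn.1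
    have hnx : (n : ℝ) ≤ x := (Nat.le_floor_iff hx).1 hn.2
    rw [div_mul_eq_mul_div, le_div_iff₀ (by positivity)]
    gcongr
  refine h2.trans ?_
  gcongr
  exact hsum.sum_le_tsum _ fun n _ => by positivity

theorem LSeries_divisorFn_eq_integral (k : ℕ) {s : ℂ} (hs : 2 < s.re) :
    ∫ t in Set.Ioi (1 : ℝ), (divisorSum k t : ℂ) * (t : ℂ) ^ (-(s + 1)) =
      riemannZeta s ^ k / s := by
  obtain ⟨C, hC0, hC⟩ := exists_divisorSum_le k
  have h1 := LSeries_eq_mul_integral_of_nonneg (fun n => (divisorFn k n : ℝ)) zero_le_two hs (by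
    refine Asymptotics.IsBigO.of_bound C (.of_forall fun n => ?_)
    have := hC n n.cast_nonneg
    rw [divisorSum, Nat.floor_natCast] at this
    rw [Real.norm_of_nonneg (Finset.sum_nonneg fun _ _ => Nat.cast_nonneg _),
      Real.norm_of_nonneg (by positivity)]
    simpa using this) (fun n => Nat.cast_nonneg _)
  have h2 := (LSeriesHasSum_divisorFn k (s := s) (by linarith)).LSeries_eq
  simp only [Complex.ofReal_natCast] at h1
  rw [h2] at h1
  have hs0 : s ≠ 0 := fun h => by simp [h] at hs; linarith
  rw [h1, mul_div_cancel_left₀ _ hs0]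
  simp [divisorSum]

theorem Complex.ofReal_exp_cpow (u : ℝ) (s : ℂ) :
    ((Real.exp u : ℝ) : ℂ) ^ s = Complex.exp (s * u) := by
  rw [Complex.cpow_def_of_ne_zero (by exact_mod_cast (Real.exp_pos u).ne'),
    ← Complex.ofReal_log (Real.exp_pos u).le, Real.log_exp, mul_comm]

/-- Substitute t = e^u in the Abel summation integral; the Jacobian turns t^{-(s+1)} into e^{-su}.
-/
theorem integral_divisorSum_exp (k : ℕ) {s : ℂ} (hs : 2 < s.re) :
    ∫ u in Set.Ioi (0 : ℝ), (divisorSum k (Real.exp u) : ℂ) * Complex.exp (-(s * u)) =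
      riemannZeta s ^ k / s := by
  rw [← LSeries_divisorFn_eq_integral k hs, ← Real.exp_zero, ← Real.image_exp_Ioi,
    integral_image_eq_integral_abs_deriv_smul measurableSet_Ioi
      (fun x _ => (Real.hasDerivAt_exp x).hasDerivWithinAt) Real.exp_injective.injOn]
  refine setIntegral_congr_fun measurableSet_Ioi fun u _ => ?_
  simp only [Real.abs_exp, Complex.real_smul]
  rw [mul_left_comm, Complex.ofReal_exp_cpow, Complex.ofReal_exp, ← Complex.exp_add]
  congr 2
  ring

theorem integrableOn_divisorSum_exp (k : ℕ) {c : ℝ} (hc : 2 < c) :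
    IntegrableOn (fun u : ℝ => (divisorSum k (Real.exp u) : ℂ) * Complex.exp (-(c * u)))
      (Set.Ioi 0) := by
  obtain ⟨C, hC0, hC⟩ := exists_divisorSum_le k
  have h1 : IntegrableOn (fun u : ℝ => C * Real.exp (-(c - 2) * u)) (Set.Ioi 0) :=
    (integrableOn_exp_mul_Ioi (by linarith) 0).const_mul C
  refine h1.mono' ?_ (.of_forall fun u => ?_)
  · refine AEStronglyMeasurable.mul ?_ (by fun_prop)
    exact (Complex.measurable_ofReal.comp ((monotone_divisorSum k).measurable.comp
      Real.measurable_exp)).aestronglyMeasurable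
  · rw [norm_mul, Complex.norm_real, Real.norm_of_nonneg (divisorSum_nonneg _ _),
      Complex.norm_exp]
    have h2 := hC _ (Real.exp_pos u).le
    calc divisorSum k (Real.exp u) * Real.exp (-(c * u : ℂ)).re
        ≤ C * Real.exp u ^ 2 * Real.exp (-(c * u)) := by
          gcongr
          simp
      _ = C * Real.exp (-(c - 2) * u) := by
          rw [← Real.exp_nat_mul, mul_assoc, ← Real.exp_add]
          congr 2
          push_cast
          ring

theorem integrableOn_pow_mul_cexp (j : ℕ) {z : ℂ} (hz : 0 < z.re) :
    IntegrableOn (fun u : ℝ => (u : ℂ) ^ j * Complex.exp (-(z * u))) (Set.Ioi 0) := by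
  have h1 := integrableOn_rpow_mul_exp_neg_mul_rpow (s := j) (p := 1)
    (by have : (0 : ℝ) ≤ j := j.cast_nonneg; linarith) one_pos hz
  refine h1.mono' (by fun_prop) ?_
  refine (ae_restrict_iff' measurableSet_Ioi).2 (.of_forall fun u hu => ?_)
  have hu0 : 0 < u := hu
  rw [norm_mul, norm_pow, Complex.norm_real, Real.norm_of_nonneg hu0.le, Complex.norm_exp,
    Real.rpow_natCast, Real.rpow_one]
  simp

/-- Integration by parts, inductively in `j`. These are the transforms that turn the powers of log x
in the main term into the polar terms at s = 1. -/
theorem integral_pow_div_factorial_mul_cexp (j : ℕ) {z : ℂ} (hz : 0 < z.re) :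
    ∫ u in Set.Ioi (0 : ℝ), (u : ℂ) ^ j / j.factorial * Complex.exp (-(z * u)) =
      1 / z ^ (j + 1) := by
  have hz0 : z ≠ 0 := fun h => by simp [h] at hz
  have hint : ∀ j : ℕ, IntegrableOn (fun u : ℝ => (u : ℂ) ^ j / j.factorial *
      Complex.exp (-(z * u))) (Set.Ioi 0) := fun j => by
    refine IntegrableOn.congr_fun (f := fun u : ℝ => (j.factorial : ℂ)⁻¹ *
      ((u : ℂ) ^ j * Complex.exp (-(z * u))))
      ((integrableOn_pow_mul_cexp j hz).const_mul _) (fun u _ => ?_) measurableSet_Ioi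
    simp only
    ring
  induction j with
  | zero =>
    have := integral_exp_mul_complex_Ioi (a := -z) (by simpa using hz) 0
    simp only [neg_mul] at this
    simp [this]
  | succ j ih =>
    have hderiv : ∀ u : ℝ, HasDerivAt (fun u : ℝ => (u : ℂ) ^ (j + 1) / (j + 1).factorial *
        Complex.exp (-(z * u))) ((u : ℂ) ^ j / j.factorial * Complex.exp (-(z * u)) -
        z * ((u : ℂ) ^ (j + 1) / (j + 1).factorial * Complex.exp (-(z * u)))) u := by
      intro u
      have h1 : HasDerivAt (fun u : ℂ => u ^ (j + 1) / (j + 1).factorial *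
        Complex.exp (-(z * u))) (((j + 1 : ℕ) * (u : ℂ) ^ j) / (j + 1).factorial *
          Complex.exp (-(z * u)) + (u : ℂ) ^ (j + 1) / (j + 1).factorial *
          (Complex.exp (-(z * u)) * (-(z * 1)))) u :=
        ((hasDerivAt_pow (j + 1) (u : ℂ)).div_const _).mul
          (((hasDerivAt_id (u : ℂ)).const_mul z).neg.cexp)
      convert! h1.comp_ofReal using 1
      rw [Nat.factorial_succ]
      have : (j.factorial : ℂ) ≠ 0 := by exact_mod_cast j.factorial_ne_zero
      have : ((j : ℂ) + 1) ≠ 0 := by exact_mod_cast j.succ_ne_zero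
      push_cast
      field_simp
      ring
    have hlim : Tendsto (fun u : ℝ => (u : ℂ) ^ (j + 1) / (j + 1).factorial *
        Complex.exp (-(z * u))) atTop (𝓝 0) := by
      rw [tendsto_zero_iff_norm_tendsto_zero]
      have h1 := (tendsto_rpow_mul_exp_neg_mul_atTop_nhds_zero (j + 1 : ℕ) z.re hz).div_const
        ((j + 1).factorial : ℝ)
      rw [zero_div] at h1
      refine h1.congr' ?_
      filter_upwards [eventually_gt_atTop 0] with u hu
      rw [norm_mul, norm_div, norm_pow, Complex.norm_real, Real.norm_of_nonneg hu.le,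
        Complex.norm_exp, Real.rpow_natCast]
      simp
      ring
    have h1 := integral_Ioi_of_hasDerivAt_of_tendsto' (a := 0) (fun u _ => hderiv u)
      ((hint j).sub ((hint (j + 1)).const_mul z)) hlim
    rw [integral_sub (hint j) ((hint (j + 1)).const_mul z), integral_const_mul, ih] at h1
    simp only [Complex.ofReal_zero, ne_eq, Nat.add_eq_zero_iff, one_ne_zero, and_false,
      not_false_eq_true, zero_pow, zero_div, zero_mul, sub_zero] at h1
    rw [pow_succ z (j + 1), ← div_div, sub_eq_zero.1 h1, mul_div_cancel_left₀ _ hz0]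

end

/-! ### The main term and the transform of the error term -/

theorem circleIntegral_cpow_div_sub_pow {x : ℝ} (hx : 0 < x) {r : ℝ} (hr : 0 < r) (n : ℕ) :
    ∮ s in C(1, r), 1 / (s - 1) ^ (n + 1) * (x : ℂ) ^ s =
      2 * Real.pi * Complex.I * (x * (Real.log x : ℂ) ^ n / n.factorial) := by
  have hx0 : (x : ℂ) ≠ 0 := by exact_mod_cast hx.ne'
  have hfun : (fun s : ℂ => (x : ℂ) ^ s) = fun s => Complex.exp ((Real.log x : ℂ) * s) := by
    ext s
    rw [Complex.cpow_def_of_ne_zero hx0, Complex.ofReal_log hx.le]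
  have h1 := (show Differentiable ℂ (fun s : ℂ => (x : ℂ) ^ s) by
    rw [hfun]; fun_prop).differentiableOn (s := Metric.closedBall 1 r)
    |>.circleIntegral_one_div_sub_center_pow_smul hr n
  simp only [smul_eq_mul] at h1
  rw [h1, hfun, iteratedDeriv_cexp_const_mul]
  simp only [mul_one]
  rw [← Complex.ofReal_exp, Real.exp_log hx]
  ring

/-- The main term as a polynomial in `log x`. -/
theorem mainTerm_eq {k : ℕ} {a : ℕ → ℂ} {E : ℂ → ℂ}
    (hE : DifferentiableOn ℂ E {s : ℂ | 0 < s.re})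
    (h : ∀ s, s ≠ 1 → riemannZeta s ^ k / s =
      ∑ i ∈ Finset.range k, a i / (s - 1) ^ (k - i) + E s) {x : ℝ} (hx : 0 < x) :
    mainTerm k x = ∑ i ∈ Finset.range k,
      a i * (x * (Real.log x : ℂ) ^ (k - 1 - i) / (k - 1 - i).factorial) := by
  refine Tendsto.limUnder_eq ?_
  refine tendsto_const_nhds.congr' ?_
  -- For r < 1 the closed disc lies in Re s > 0, so `E` contributes nothing, and Cauchy's formula
  -- for the derivatives of x^s evaluates each polar term independently of r.
  filter_upwards [Ioo_mem_nhdsGT (zero_lt_one' ℝ)] with r hr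
  have hx0 : (x : ℂ) ≠ 0 := by exact_mod_cast hx.ne'
  have hxd : Differentiable ℂ fun s : ℂ => (x : ℂ) ^ s := fun s =>
    differentiableAt_id.const_cpow (Or.inl hx0)
  have hball : Metric.closedBall (1 : ℂ) r ⊆ {s : ℂ | 0 < s.re} := by
    intro s hs
    have h1 := (Complex.abs_re_le_norm (s - 1)).trans (mem_closedBall_iff_norm.1 hs)
    rw [Complex.sub_re, Complex.one_re] at h1
    have := (abs_le.1 h1).1
    simp only [Set.mem_ofPred_eq]
    linarith [hr.2]
  have hs1 : ∀ s ∈ Metric.sphere (1 : ℂ) r, s - 1 ≠ 0 := by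
    intro s hs h0
    rw [mem_sphere_iff_norm, h0, norm_zero] at hs
    exact hr.1.ne hs
  have hEd : DifferentiableOn ℂ (fun s => E s * (x : ℂ) ^ s) (Metric.closedBall 1 r) :=
    (hE.mono hball).mul hxd.differentiableOn
  have hcongr : ∮ s in C(1, r), riemannZeta s ^ k * (x : ℂ) ^ s / s =
      ∮ s in C(1, r), ((∑ i ∈ Finset.range k, a i * (1 / (s - 1) ^ (k - 1 - i + 1) *
        (x : ℂ) ^ s)) + E s * (x : ℂ) ^ s) := by
    refine circleIntegral.integral_congr hr.1.le fun s hs => ?_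
    have : riemannZeta s ^ k * (x : ℂ) ^ s / s = riemannZeta s ^ k / s * (x : ℂ) ^ s := by ring
    rw [this, h s (sub_ne_zero.1 (hs1 s hs)), add_mul, Finset.sum_mul]
    congr 1
    refine Finset.sum_congr rfl fun i hi => ?_
    rw [show k - 1 - i + 1 = k - i by have := Finset.mem_range.1 hi; omega]
    ring
  have hci : ∀ i ∈ Finset.range k, CircleIntegrable (fun s : ℂ => a i *
      (1 / (s - 1) ^ (k - 1 - i + 1) * (x : ℂ) ^ s)) 1 r := by
    intro i _
    refine ContinuousOn.circleIntegrable hr.1.le ?_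
    refine continuousOn_const.mul (ContinuousOn.mul ?_ hxd.continuous.continuousOn)
    exact continuousOn_const.div (by fun_prop) fun s hs => pow_ne_zero _ (hs1 s hs)
  rw [hcongr, circleIntegral.integral_add, circleIntegral.integral_fun_sum hci,
    DiffContOnCl.circleIntegral_eq_zero hr.1.le
      (hEd.mono Metric.closure_ball_subset_closedBall).diffContOnCl, add_zero, Finset.mul_sum]
  · refine Finset.sum_congr rfl fun i _ => ?_
    rw [circleIntegral.integral_const_mul, circleIntegral_cpow_div_sub_pow hx hr.1]
    have := Complex.two_pi_I_ne_zero
    rw [mul_left_comm (a i), inv_mul_cancel_left₀ this]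
  · refine (CircleIntegrable.sum _ hci).congr ?_
    intro s _
    simp
  · exact (hEd.continuousOn.mono Metric.sphere_subset_closedBall).circleIntegrable hr.1.le

/-- The complex-valued error term in the logarithmic variable, cut off to `u > 0`. -/
noncomputable def logDelta (k : ℕ) (u : ℝ) : ℂ :=
  (Set.Ioi 0).indicator
    (fun u => (divisorSum k (Real.exp u) : ℂ) - mainTerm k (Real.exp u)) u

/-- Since |Re z| ≤ |z|, the complex-valued error term dominates and the reality of the residue never
has to be shown. -/
theorem norm_logDelta_log {k : ℕ} {x y : ℝ} (hx : 1 < x) (hy : 1 < y) :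
    |Delta k y - Delta k x| ≤ ‖logDelta k (Real.log y) - logDelta k (Real.log x)‖ := by
  have h : ∀ z : ℝ, 1 < z → logDelta k (Real.log z) = divisorSum k z - mainTerm k z := by
    intro z hz
    rw [logDelta, Set.indicator_of_mem (Set.mem_Ioi.2 (Real.log_pos hz)), Real.exp_log (by linarith)]
  rw [h y hy, h x hx]
  refine le_trans (le_of_eq ?_) (Complex.abs_re_le_norm _)
  simp [Delta, divisorSum]

section transform

variable {k : ℕ} {a : ℕ → ℂ} {E : ℂ → ℂ}

theorem mainTerm_exp_eq (hE : DifferentiableOn ℂ E {s : ℂ | 0 < s.re})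
    (h : ∀ s, s ≠ 1 → riemannZeta s ^ k / s =
      ∑ i ∈ Finset.range k, a i / (s - 1) ^ (k - i) + E s) (u : ℝ) (s : ℂ) :
    mainTerm k (Real.exp u) * Complex.exp (-(s * u)) = ∑ i ∈ Finset.range k,
      a i * ((u : ℂ) ^ (k - 1 - i) / (k - 1 - i).factorial * Complex.exp (-((s - 1) * u))) := by
  rw [mainTerm_eq hE h (Real.exp_pos u), Finset.sum_mul]
  refine Finset.sum_congr rfl fun i _ => ?_
  have : Complex.exp (-((s - 1) * u)) = Complex.exp u * Complex.exp (-(s * u)) := by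
    rw [← Complex.exp_add]; congr 1; ring
  rw [Real.log_exp, this, Complex.ofReal_exp]
  ring

theorem integrableOn_mainTerm_exp (hE : DifferentiableOn ℂ E {s : ℂ | 0 < s.re})
    (h : ∀ s, s ≠ 1 → riemannZeta s ^ k / s =
      ∑ i ∈ Finset.range k, a i / (s - 1) ^ (k - i) + E s) {s : ℂ} (hs : 1 < s.re) :
    IntegrableOn (fun u : ℝ => mainTerm k (Real.exp u) * Complex.exp (-(s * u)))
      (Set.Ioi 0) := by
  simp only [mainTerm_exp_eq hE h]
  refine integrable_finsetSum _ fun i _ => Integrable.const_mul ?_ _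
  refine IntegrableOn.congr_fun (f := fun u : ℝ => ((k - 1 - i).factorial : ℂ)⁻¹ *
      ((u : ℂ) ^ (k - 1 - i) * Complex.exp (-((s - 1) * u))))
      ((integrableOn_pow_mul_cexp _ (by simpa using hs)).const_mul _) (fun u _ => ?_)
      measurableSet_Ioi
  simp only
  ring

theorem integral_mainTerm_exp (hE : DifferentiableOn ℂ E {s : ℂ | 0 < s.re})
    (h : ∀ s, s ≠ 1 → riemannZeta s ^ k / s =
      ∑ i ∈ Finset.range k, a i / (s - 1) ^ (k - i) + E s) {s : ℂ} (hs : 1 < s.re) :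
    ∫ u in Set.Ioi (0 : ℝ), mainTerm k (Real.exp u) * Complex.exp (-(s * u)) =
      ∑ i ∈ Finset.range k, a i / (s - 1) ^ (k - i) := by
  simp only [mainTerm_exp_eq hE h]
  rw [integral_finsetSum]
  · refine Finset.sum_congr rfl fun i hi => ?_
    rw [integral_const_mul, integral_pow_div_factorial_mul_cexp _ (by simpa using hs),
      show k - 1 - i + 1 = k - i by have := Finset.mem_range.1 hi; omega]
    ring
  · intro i _
    refine Integrable.const_mul ?_ _
    refine IntegrableOn.congr_fun (f := fun u : ℝ => ((k - 1 - i).factorial : ℂ)⁻¹ *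
      ((u : ℂ) ^ (k - 1 - i) * Complex.exp (-((s - 1) * u))))
      ((integrableOn_pow_mul_cexp _ (by simpa using hs)).const_mul _) (fun u _ => ?_)
      measurableSet_Ioi
    simp only
    ring

theorem logDelta_mul_exp (s : ℂ) (u : ℝ) : logDelta k u * Complex.exp (-(s * u)) =
    (Set.Ioi (0 : ℝ)).indicator (fun u : ℝ => (divisorSum k (Real.exp u) : ℂ) *
      Complex.exp (-(s * u)) - mainTerm k (Real.exp u) * Complex.exp (-(s * u))) u := by
  rw [logDelta]
  by_cases hu : u ∈ Set.Ioi (0 : ℝ)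
  · rw [Set.indicator_of_mem hu, Set.indicator_of_mem hu, sub_mul]
  · rw [Set.indicator_of_notMem hu, Set.indicator_of_notMem hu, zero_mul]

theorem integrable_logDelta (hE : DifferentiableOn ℂ E {s : ℂ | 0 < s.re})
    (h : ∀ s, s ≠ 1 → riemannZeta s ^ k / s =
      ∑ i ∈ Finset.range k, a i / (s - 1) ^ (k - i) + E s) {c : ℝ} (hc : 2 < c) :
    Integrable fun u : ℝ => logDelta k u * Complex.exp (-(c * u)) := by
  simp only [logDelta_mul_exp]
  rw [integrable_indicator_iff measurableSet_Ioi]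
  exact (integrableOn_divisorSum_exp k hc).sub
    (integrableOn_mainTerm_exp hE h (by simpa using by linarith))

theorem integrable_mul_cexp_of_re_eq {f : ℝ → ℂ} {c t : ℝ} {μ : Measure ℝ}
    (hf : Integrable (fun u : ℝ => f u * Complex.exp (-(c * u))) μ) :
    Integrable (fun u : ℝ => f u * Complex.exp (-((c + t * Complex.I) * u))) μ := by
  have h1 := hf.mul_bdd (c := 1) (f := fun u : ℝ => f u * Complex.exp (-(c * u)))
    (g := fun u : ℝ => Complex.exp ((-(t * u) : ℝ) * Complex.I))
    (Continuous.aestronglyMeasurable (by fun_prop))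
    (.of_forall fun u => (Complex.norm_exp_ofReal_mul_I _).le)
  refine h1.congr (.of_forall fun u => ?_)
  simp only
  rw [mul_assoc, ← Complex.exp_add]
  congr 2
  push_cast
  ring

/-- The cut-off at u = 0 makes the transform of the main term equal to the principal part exactly,
so subtraction leaves the regular part `E`. -/
theorem integral_logDelta (hE : DifferentiableOn ℂ E {s : ℂ | 0 < s.re})
    (h : ∀ s, s ≠ 1 → riemannZeta s ^ k / s =
      ∑ i ∈ Finset.range k, a i / (s - 1) ^ (k - i) + E s) {s : ℂ} (hs : 2 < s.re) :
    ∫ u : ℝ, logDelta k u * Complex.exp (-(s * u)) = E s := by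
  simp only [logDelta_mul_exp]
  have hD : IntegrableOn (fun u : ℝ => (divisorSum k (Real.exp u) : ℂ) *
      Complex.exp (-(s * u))) (Set.Ioi 0) := by
    have := integrable_mul_cexp_of_re_eq (t := s.im) (integrableOn_divisorSum_exp k hs)
    rwa [Complex.re_add_im] at this
  rw [integral_indicator measurableSet_Ioi, integral_sub hD
    (integrableOn_mainTerm_exp hE h (by linarith)), integral_divisorSum_exp k hs,
    integral_mainTerm_exp hE h (by linarith), h s (fun h0 => by simp [h0] at hs)]
  ring

/-- The summatory function is monotone, so it has only countably many jumps; the main term is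
continuous. Pointwise Gaussian inversion needs this. -/
theorem ae_continuousAt_logDelta (hE : DifferentiableOn ℂ E {s : ℂ | 0 < s.re})
    (h : ∀ s, s ≠ 1 → riemannZeta s ^ k / s =
      ∑ i ∈ Finset.range k, a i / (s - 1) ^ (k - i) + E s) :
    ∀ᵐ u : ℝ, ContinuousAt (logDelta k) u := by
  have hmono : Monotone fun u => divisorSum k (Real.exp u) :=
    (monotone_divisorSum k).comp Real.exp_monotone
  have h1 := hmono.countable_not_continuousAt.ae_notMem volume
  have h2 : ∀ᵐ u : ℝ, u ≠ 0 := (Set.countable_singleton (0 : ℝ)).ae_notMem volume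
  filter_upwards [h1, h2] with u hu1 hu2
  have hu1' : ContinuousAt (fun u => divisorSum k (Real.exp u)) u := by
    simpa using hu1
  rcases lt_or_gt_of_ne hu2 with hu | hu
  · refine continuousAt_const.congr (f := fun _ => 0) ?_
    filter_upwards [Iio_mem_nhds hu] with v hv
    rw [logDelta, Set.indicator_of_notMem]
    exact not_lt.2 (le_of_lt (Set.mem_Iio.1 hv))
  · have h3 : ContinuousAt (fun u : ℝ => (divisorSum k (Real.exp u) : ℂ) - ∑ i ∈ Finset.range k,
        a i * ((Real.exp u : ℂ) * (u : ℂ) ^ (k - 1 - i) / (k - 1 - i).factorial)) u := by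
      refine ContinuousAt.sub (Complex.continuous_ofReal.continuousAt.comp hu1') ?_
      exact Continuous.continuousAt (by fun_prop)
    refine h3.congr ?_
    filter_upwards [Ioi_mem_nhds hu] with v hv
    rw [logDelta, Set.indicator_of_mem hv, mainTerm_eq hE h (Real.exp_pos v)]
    simp

end transform

/-! ### Mean square of multiplicative differences -/

theorem lintegral_comp_mul_left_of_pos {a : ℝ} (ha : 0 < a) {f : ℝ → ℝ≥0∞} (hf : Measurable f) :
    ∫⁻ x, f (a * x) = ENNReal.ofReal a⁻¹ * ∫⁻ x, f x := by
  rw [← lintegral_map hf (measurable_const_mul a), Real.map_volume_mul_left ha.ne',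
    lintegral_smul_measure, abs_of_pos (inv_pos.2 ha), smul_eq_mul]

theorem lintegral_Ioi_two_mul_inv_cube {m : ℝ} (hm : 0 < m) :
    ∫⁻ τ in Set.Ioi m, ENNReal.ofReal (2 * τ ^ (-3 : ℝ)) = ENNReal.ofReal ((m ^ 2)⁻¹) := by
  rw [← ofReal_integral_eq_lintegral_ofReal
    ((integrableOn_Ioi_rpow_of_lt (by norm_num) hm).const_mul 2)
    ((ae_restrict_iff' measurableSet_Ioi).2 (.of_forall fun τ hτ => by
      have : 0 < τ := hm.trans hτ
      positivity)), integral_const_mul, integral_Ioi_rpow_of_lt (by norm_num) hm]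
  congr 1
  have : m ^ (-3 + 1 : ℝ) = (m ^ 2)⁻¹ := by
    rw [show (-3 + 1 : ℝ) = -(2 : ℕ) by norm_num, Real.rpow_neg hm.le, Real.rpow_natCast]
  rw [this]
  ring

/-- Partial summation: a weight `max(N, |t|)⁻²` against a density whose mass in `|t| < τ` is
`O(τ^{1+η})`. -/
theorem lintegral_mul_inv_max_sq_le {Z : ℝ → ℝ≥0∞} (hZ : Measurable Z) {A η : ℝ} (hA : 0 ≤ A)
    (hη : η < 1)
    (h : ∀ τ : ℝ, 1 ≤ τ → ∫⁻ t in Set.Ioo (-τ) τ, Z t ≤ ENNReal.ofReal (A * τ ^ (1 + η)))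
    {N : ℝ} (hN : 1 ≤ N) :
    ∫⁻ t, Z t * ENNReal.ofReal (((max N |t|) ^ 2)⁻¹) ≤
      ENNReal.ofReal (2 * A / (1 - η) * N ^ (η - 1)) := by
  have hN0 : 0 < N := by linarith
  -- Layer-cake form of the weight: max(N,|t|)^{-2} is the integral of 2τ^{-3} over τ > max(N,|t|).
  -- After Tonelli the mass bound enters for each τ, and the integral of τ^{η-2} converges because η
  -- < 1.
  have h1 : ∀ t : ℝ, Z t * ENNReal.ofReal (((max N |t|) ^ 2)⁻¹) = ∫⁻ τ in Set.Ioi N,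
      (Set.Ioi |t|).indicator (fun τ => Z t * ENNReal.ofReal (2 * τ ^ (-3 : ℝ))) τ := by
    intro t
    rw [← lintegral_Ioi_two_mul_inv_cube (lt_max_of_lt_left hN0),
      ← lintegral_const_mul _ (by fun_prop), setLIntegral_indicator measurableSet_Ioi,
      Set.Ioi_inter_Ioi, sup_comm]
  simp only [h1]
  rw [lintegral_lintegral_swap]
  · have h2 : ∀ τ ∈ Set.Ioi N, ∫⁻ t, (Set.Ioi |t|).indicator
        (fun τ => Z t * ENNReal.ofReal (2 * τ ^ (-3 : ℝ))) τ ≤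
        ENNReal.ofReal (2 * A * τ ^ (η - 2)) := by
      intro τ hτ
      have hτ0 : 0 < τ := hN0.trans hτ
      have e1 : ∀ t : ℝ, (Set.Ioi |t|).indicator
          (fun τ => Z t * ENNReal.ofReal (2 * τ ^ (-3 : ℝ))) τ =
          (Set.Ioo (-τ) τ).indicator (fun t => ENNReal.ofReal (2 * τ ^ (-3 : ℝ)) * Z t) t := by
        intro t
        by_cases ht : |t| < τ
        · rw [Set.indicator_of_mem (Set.mem_Ioi.2 ht), Set.indicator_of_mem
            (Set.mem_Ioo.2 (abs_lt.1 ht)), mul_comm]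
        · rw [Set.indicator_of_notMem (fun h => ht (Set.mem_Ioi.1 h)), Set.indicator_of_notMem
            (s := Set.Ioo (-τ) τ) (fun h => ht (abs_lt.2 ⟨h.1, h.2⟩))]
      simp only [e1]
      rw [lintegral_indicator measurableSet_Ioo, lintegral_const_mul _ hZ]
      calc _ ≤ ENNReal.ofReal (2 * τ ^ (-3 : ℝ)) * ENNReal.ofReal (A * τ ^ (1 + η)) := by
            gcongr
            exact h τ (hN.trans (le_of_lt hτ))
        _ = _ := by
            rw [← ENNReal.ofReal_mul (by positivity)]
            congr 1
            have : τ ^ (η - 2) = τ ^ (-3 : ℝ) * τ ^ (1 + η) := by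
              rw [← Real.rpow_add hτ0]; congr 1; ring
            rw [this]; ring
    refine (setLIntegral_mono (by fun_prop) h2).trans (le_of_eq ?_)
    rw [← ofReal_integral_eq_lintegral_ofReal
      ((integrableOn_Ioi_rpow_of_lt (by linarith) hN0).const_mul (2 * A))
      ((ae_restrict_iff' measurableSet_Ioi).2 (.of_forall fun τ hτ => by
        have : 0 < τ := hN0.trans hτ
        positivity)), integral_const_mul, integral_Ioi_rpow_of_lt (by linarith) hN0]
    congr 1
    rw [show η - 2 + 1 = -(1 - η) by ring, neg_div_neg_eq, show η - 1 = -(1 - η) by ring]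
    ring
  · have hset : MeasurableSet {p : ℝ × ℝ | |p.1| < p.2} :=
      measurableSet_lt (by fun_prop) measurable_snd
    have : Function.uncurry (fun t τ : ℝ => (Set.Ioi |t|).indicator
        (fun τ => Z t * ENNReal.ofReal (2 * τ ^ (-3 : ℝ))) τ) =
        {p : ℝ × ℝ | |p.1| < p.2}.indicator
          fun p => Z p.1 * ENNReal.ofReal (2 * p.2 ^ (-3 : ℝ)) := by
      ext p
      rfl
    rw [this]
    refine Measurable.aemeasurable (Measurable.indicator ?_ hset)
    fun_prop

/-- If θ|s| ≤ 1, use |e^z - 1| ≤ 2|z|. Otherwise |s| dominates both 1/θ and |Im s|, and the trivial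
bound e^σ + 1 is enough. -/
theorem norm_cexp_sub_one_div_le {s : ℂ} {θ σ : ℝ} (hσ : 0 < σ) (hs : s.re = σ) (hθ : 0 < θ)
    (hθ1 : θ ≤ 1) :
    ‖Complex.exp (θ * s) - 1‖ ≤ (Real.exp σ + 2) * ‖s‖ / max (1 / θ) |s.im| := by
  have hs0 : 0 < ‖s‖ := by
    rw [norm_pos_iff]
    intro h
    rw [h] at hs
    simp at hs
    linarith
  have hmax : 0 < max (1 / θ) |s.im| := lt_max_of_lt_left (by positivity)
  have him := Complex.abs_im_le_norm s
  rw [le_div_iff₀ hmax]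
  have hnorm : ‖(θ : ℂ) * s‖ = θ * ‖s‖ := by
    rw [norm_mul, Complex.norm_real, Real.norm_of_nonneg hθ.le]
  by_cases hle : θ * ‖s‖ ≤ 1
  · have h1 := Complex.norm_exp_sub_one_le (x := θ * s) (by rw [hnorm]; exact hle)
    rw [hnorm] at h1
    have h2 : ‖s‖ ≤ 1 / θ := by rw [le_div_iff₀ hθ]; linarith
    rw [max_eq_left (him.trans h2)]
    calc ‖Complex.exp (θ * s) - 1‖ * (1 / θ) ≤ 2 * (θ * ‖s‖) * (1 / θ) := by gcongr
      _ = 2 * ‖s‖ := by field_simp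
      _ ≤ _ := by
        gcongr
        linarith [Real.exp_pos σ]
  · push Not at hle
    have h2 : 1 / θ ≤ ‖s‖ := by rw [div_le_iff₀ hθ]; linarith
    have h3 : ‖Complex.exp (θ * s) - 1‖ ≤ Real.exp σ + 2 := by
      refine (norm_sub_le _ _).trans ?_
      rw [Complex.norm_exp, norm_one]
      have : ((θ : ℂ) * s).re ≤ σ := by
        simp only [Complex.mul_re, Complex.ofReal_re, Complex.ofReal_im, zero_mul, sub_zero, hs]
        nlinarith
      linarith [Real.exp_le_exp.2 this]
    gcongr
    exact max_le h2 him

/-- Every polar term has order at least 1, hence is O(1/|s|) on a vertical line at positive distance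
from 1. This is where σ ≠ 1 is needed. -/
theorem norm_principalPart_le (a : ℕ → ℂ) (k : ℕ) {σ : ℝ} (hσ : σ ≠ 1) :
    ∃ P : ℝ, 0 ≤ P ∧ ∀ s : ℂ, s.re = σ →
      ‖∑ i ∈ Finset.range k, a i / (s - 1) ^ (k - i)‖ * ‖s‖ ≤ P := by
  set d : ℝ := |σ - 1| with hd
  have hd0 : 0 < d := abs_pos.2 (sub_ne_zero.2 hσ)
  refine ⟨∑ i ∈ Finset.range k, ‖a i‖ / d ^ (k - i - 1) * (1 + 1 / d),
    Finset.sum_nonneg fun i _ => by positivity, fun s hs => ?_⟩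
  have h1 : d ≤ ‖s - 1‖ := by
    have := Complex.abs_re_le_norm (s - 1)
    rwa [Complex.sub_re, Complex.one_re, hs] at this
  have hs1 : 0 < ‖s - 1‖ := hd0.trans_le h1
  have h2 : ‖s‖ ≤ (1 + 1 / d) * ‖s - 1‖ := by
    have h3 : ‖s‖ ≤ ‖s - 1‖ + 1 := by
      have := norm_add_le (s - 1) 1
      simpa using this
    have h4 : 1 ≤ 1 / d * ‖s - 1‖ := by
      rw [div_mul_eq_mul_div, one_mul, le_div_iff₀ hd0, one_mul]; exact h1
    linarith
  calc _ ≤ (∑ i ∈ Finset.range k, ‖a i / (s - 1) ^ (k - i)‖) * ‖s‖ := by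
        gcongr
        exact norm_sum_le _ _
    _ = ∑ i ∈ Finset.range k, ‖a i / (s - 1) ^ (k - i)‖ * ‖s‖ := Finset.sum_mul ..
    _ ≤ _ := by
      refine Finset.sum_le_sum fun i hi => ?_
      have hik : k - i = (k - i - 1) + 1 := by have := Finset.mem_range.1 hi; omega
      rw [norm_div, norm_pow]
      conv_lhs => rw [hik, pow_succ]
      calc ‖a i‖ / (‖s - 1‖ ^ (k - i - 1) * ‖s - 1‖) * ‖s‖
          ≤ ‖a i‖ / (‖s - 1‖ ^ (k - i - 1) * ‖s - 1‖) * ((1 + 1 / d) * ‖s - 1‖) := by gcongr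
        _ = ‖a i‖ / ‖s - 1‖ ^ (k - i - 1) * (1 + 1 / d) := by field_simp
        _ ≤ _ := by gcongr

/-- The mean square of a multiplicative difference of the error term, in logarithmic variables. -/
theorem lintegral_logDelta_shift_le (k : ℕ) {σ A η : ℝ} (hσ : 0 < σ) (hσ1 : σ ≠ 1) (hA : 0 ≤ A)
    (hη0 : 0 < η) (hη : η < 1)
    (hZ : ∀ τ : ℝ, 1 ≤ τ → ∫⁻ t in Set.Ioo (-τ) τ,
      ENNReal.ofReal (‖riemannZeta (σ + t * Complex.I)‖ ^ (2 * k)) ≤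
        ENNReal.ofReal (A * τ ^ (1 + η))) :
    ∃ C : ℝ, 0 ≤ C ∧ ∀ θ : ℝ, 0 < θ → θ ≤ 1 →
      ∫⁻ u : ℝ, ‖(logDelta k (u + θ) - logDelta k u) * Complex.exp (-(σ * u))‖ₑ ^ 2 ≤
        ENNReal.ofReal (C * θ ^ (1 - η)) := by
  obtain ⟨a, E, hE, h0, h1⟩ := exists_zeta_pow_expansion k
  obtain ⟨P, hP0, hP⟩ := norm_principalPart_le a k hσ1
  -- The starting line must satisfy c > 2, where the transform of φ is known.
  set c : ℝ := σ + 3 with hc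
  obtain ⟨B, hB0, hB⟩ := norm_remainder_le hE h0 (c := c) hσ
  set G : ℝ := Real.exp σ + 2 with hG
  have hG0 : 0 < G := by positivity
  have hline : ∀ t : ℝ, (σ : ℂ) + t * Complex.I ≠ 1 := fun t h => by
    have := congrArg Complex.re h
    simp at this
    exact hσ1 this
  have hZc : Continuous fun t : ℝ => riemannZeta (σ + t * Complex.I) := by
    rw [continuous_iff_continuousAt]
    intro t
    exact ContinuousAt.comp (g := riemannZeta) (differentiableAt_riemannZeta (hline t)).continuousAt
      (by fun_prop)
  -- This density comes from (|ζ|^k + P)² ≤ 2(|ζ|^{2k} + P²), with P bounding |s| times the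
  -- principal part and G the constant for e^{θs} - 1.
  set Z : ℝ → ℝ≥0∞ := fun t => ENNReal.ofReal (2 * G ^ 2) *
    (ENNReal.ofReal (‖riemannZeta (σ + t * Complex.I)‖ ^ (2 * k)) + ENNReal.ofReal (P ^ 2))
    with hZdef
  have hZm : Measurable Z := by
    refine Measurable.const_mul (Measurable.add_const ?_ _) _
    exact (Continuous.measurable (by fun_prop)).ennreal_ofReal
  have hZb : ∀ τ : ℝ, 1 ≤ τ → ∫⁻ t in Set.Ioo (-τ) τ, Z t ≤
      ENNReal.ofReal (2 * G ^ 2 * (A + 2 * P ^ 2) * τ ^ (1 + η)) := by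
    intro τ hτ
    rw [lintegral_const_mul' _ _ ENNReal.ofReal_ne_top, lintegral_add_right _ measurable_const,
      lintegral_const, Measure.restrict_apply_univ, Real.volume_Ioo]
    calc _ ≤ ENNReal.ofReal (2 * G ^ 2) * (ENNReal.ofReal (A * τ ^ (1 + η)) +
          ENNReal.ofReal (P ^ 2) * ENNReal.ofReal (τ - -τ)) := by
          gcongr
          exact hZ τ hτ
      _ = ENNReal.ofReal (2 * G ^ 2 * (A * τ ^ (1 + η) + P ^ 2 * (2 * τ))) := by
          rw [← ENNReal.ofReal_mul (by positivity), ← ENNReal.ofReal_add (by positivity)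
            (by nlinarith [sq_nonneg P]), ← ENNReal.ofReal_mul (by positivity)]
          congr 3
          ring
      _ ≤ _ := by
          refine ENNReal.ofReal_le_ofReal ?_
          have : τ ≤ τ ^ (1 + η) := by
            conv_lhs => rw [← Real.rpow_one τ]
            exact Real.rpow_le_rpow_of_exponent_le hτ (by linarith)
          calc 2 * G ^ 2 * (A * τ ^ (1 + η) + P ^ 2 * (2 * τ))
              ≤ 2 * G ^ 2 * (A * τ ^ (1 + η) + P ^ 2 * (2 * τ ^ (1 + η))) := by gcongr
            _ = _ := by ring
  refine ⟨2 * (2 * G ^ 2 * (A + 2 * P ^ 2)) / (1 - η), by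
    have : 0 < 1 - η := by linarith
    positivity, fun θ hθ hθ1 => ?_⟩
  set Eθ : ℂ → ℂ := fun s => E s * (Complex.exp (θ * s) - 1) with hEθ
  have hbase := integrable_logDelta hE h1 (c := c) (by linarith)
  have hshift : ∀ (s : ℂ) (u : ℝ), logDelta k (u + θ) * Complex.exp (-(s * u)) =
      Complex.exp (θ * s) * (logDelta k (u + θ) * Complex.exp (-(s * (u + θ : ℝ)))) := by
    intro s u
    rw [mul_left_comm, ← Complex.exp_add]
    congr 2
    push_cast
    ring
  have hbound : ∀ t : ℝ, ‖Eθ (σ + t * Complex.I)‖ₑ ^ 2 ≤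
      Z t * ENNReal.ofReal (((max (1 / θ) |t|) ^ 2)⁻¹) := by
    intro t
    set s : ℂ := σ + t * Complex.I with hs
    have hsre : s.re = σ := by simp [hs]
    have hsim : s.im = t := by simp [hs]
    have hs0 : s ≠ 0 := fun h => by rw [h] at hsre; simp at hsre; linarith
    have hsn : 0 < ‖s‖ := norm_pos_iff.2 hs0
    have hmax : 0 < max (1 / θ) |t| := lt_max_of_lt_left (by positivity)
    have e1 := norm_cexp_sub_one_div_le hσ hsre hθ hθ1
    rw [hsim] at e1
    have e2 : ‖E s‖ * ‖s‖ ≤ ‖riemannZeta s‖ ^ k + P := by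
      have e3 : E s = riemannZeta s ^ k / s - ∑ i ∈ Finset.range k, a i / (s - 1) ^ (k - i) := by
        rw [h1 s (hline t)]; ring
      calc ‖E s‖ * ‖s‖ ≤ (‖riemannZeta s ^ k / s‖ +
            ‖∑ i ∈ Finset.range k, a i / (s - 1) ^ (k - i)‖) * ‖s‖ := by
            rw [e3]
            gcongr
            exact norm_sub_le _ _
        _ ≤ _ := by
            rw [add_mul, norm_div, norm_pow, div_mul_cancel₀ _ hsn.ne']
            gcongr
            exact hP s hsre
    have e4 : ‖Eθ s‖ ≤ (‖riemannZeta s‖ ^ k + P) * G / max (1 / θ) |t| := by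
      rw [hEθ, norm_mul]
      calc _ ≤ ‖E s‖ * (G * ‖s‖ / max (1 / θ) |t|) := by gcongr
        _ = (‖E s‖ * ‖s‖) * G / max (1 / θ) |t| := by ring
        _ ≤ _ := by gcongr
    rw [← ofReal_norm, ← ENNReal.ofReal_pow (norm_nonneg _), hZdef]
    simp only
    rw [← ENNReal.ofReal_add (by positivity) (by positivity), ← ENNReal.ofReal_mul (by positivity),
      ← ENNReal.ofReal_mul (by positivity)]
    refine ENNReal.ofReal_le_ofReal ?_
    calc ‖Eθ s‖ ^ 2 ≤ ((‖riemannZeta s‖ ^ k + P) * G / max (1 / θ) |t|) ^ 2 := by gcongr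
      _ = G ^ 2 * (‖riemannZeta s‖ ^ k + P) ^ 2 * ((max (1 / θ) |t|) ^ 2)⁻¹ := by
        rw [div_pow, mul_pow]; ring
      _ ≤ G ^ 2 * (2 * (‖riemannZeta s‖ ^ (2 * k) + P ^ 2)) * ((max (1 / θ) |t|) ^ 2)⁻¹ := by
        gcongr
        rw [mul_comm 2 k, pow_mul]
        nlinarith [sq_nonneg (‖riemannZeta s‖ ^ k - P)]
      _ = _ := by ring
  have hEθd : DifferentiableOn ℂ Eθ {s : ℂ | 0 < s.re} :=
    hE.mul (by fun_prop)
  have hmain := lintegral_enorm_sq_le_of_laplace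
    (φ := fun u => logDelta k (u + θ) - logDelta k u) (E := Eθ) (σ := σ) (c := c)
    (B := B * (Real.exp c + 1)) (m := 2 * k) (by linarith) (by
      simp only [sub_mul, hshift]
      exact ((hbase.comp_add_right θ).const_mul _).sub hbase) (by
      intro t
      have hb1 := integrable_mul_cexp_of_re_eq (t := t) hbase
      simp only [sub_mul, hshift]
      rw [integral_sub ((hb1.comp_add_right θ).const_mul _) hb1, integral_const_mul,
        integral_add_right_eq_self
          (fun u : ℝ => logDelta k u * Complex.exp (-((c + t * Complex.I) * u))),
        integral_logDelta hE h1 (by simp; linarith)]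
      simp only [hEθ]
      ring) (hEθd.mono fun s hs => hσ.trans_le hs.1) (by
      intro s hs
      simp only [hEθ, norm_mul]
      rw [mul_right_comm]
      gcongr
      · exact hB s hs
      · refine (norm_sub_le _ _).trans ?_
        rw [norm_one, Complex.norm_exp]
        gcongr
        have hs2 : s.re ≤ c := hs.2
        have hs1 : σ ≤ s.re := hs.1
        simp only [Complex.mul_re, Complex.ofReal_re, Complex.ofReal_im, zero_mul, sub_zero]
        nlinarith) (by
      have hc1 := ae_continuousAt_logDelta hE h1
      have hc2 := (measurePreserving_add_right volume θ).quasiMeasurePreserving.ae hc1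
      filter_upwards [hc1, hc2] with u hu1 hu2
      exact (ContinuousAt.comp (f := fun u => u + θ) hu2 (by fun_prop)).sub hu1)
  refine hmain.trans ?_
  -- The substitution t = 2πw gives a factor 1/(2π) ≤ 1, which is dropped.
  have hscale : ∫⁻ w : ℝ, ‖Eθ (σ + 2 * Real.pi * w * Complex.I)‖ₑ ^ 2 ≤
      ∫⁻ t : ℝ, ‖Eθ (σ + t * Complex.I)‖ₑ ^ 2 := by
    have hcont : Continuous fun t : ℝ => Eθ (σ + t * Complex.I) :=
      hEθd.continuousOn.comp_continuous (by fun_prop) fun t => by simpa using hσ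
    have := lintegral_comp_mul_left_of_pos (a := 2 * Real.pi) (by positivity)
      (f := fun t : ℝ => ‖Eθ (σ + t * Complex.I)‖ₑ ^ 2)
      (hcont.enorm.measurable.pow_const 2)
    push_cast at this
    rw [this]
    refine mul_le_of_le_one_left' ?_
    rw [ENNReal.ofReal_le_one]
    exact inv_le_one_of_one_le₀ (by linarith [Real.pi_gt_three])
  refine hscale.trans ((lintegral_mono hbound).trans ?_)
  have := lintegral_mul_inv_max_sq_le hZm (by positivity) hη hZb (N := 1 / θ)
    (by rw [le_div_iff₀ hθ]; linarith)
  refine this.trans (le_of_eq ?_)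
  congr 2
  rw [one_div, Real.inv_rpow hθ.le, ← Real.rpow_neg hθ.le]
  congr 1
  ring

theorem measurable_logDelta (k : ℕ) : Measurable (logDelta k) := by
  obtain ⟨a, E, hE, h0, h1⟩ := exists_zeta_pow_expansion k
  have : logDelta k = (Set.Ioi 0).indicator (fun u : ℝ => (divisorSum k (Real.exp u) : ℂ) -
      ∑ i ∈ Finset.range k,
        a i * ((Real.exp u : ℂ) * (u : ℂ) ^ (k - 1 - i) / (k - 1 - i).factorial)) := by
    ext u
    have : mainTerm k (Real.exp u) = ∑ i ∈ Finset.range k,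
        a i * ((Real.exp u : ℂ) * (u : ℂ) ^ (k - 1 - i) / (k - 1 - i).factorial) := by
      rw [mainTerm_eq hE h1 (Real.exp_pos u), Real.log_exp]
    simp only [logDelta, Set.indicator, this]
  rw [this]
  refine Measurable.indicator (Measurable.sub ?_ ?_) measurableSet_Ioi
  · exact Complex.measurable_ofReal.comp
      ((monotone_divisorSum k).measurable.comp Real.measurable_exp)
  · exact Continuous.measurable (by fun_prop)

/-! ### From multiplicative to additive differences -/

theorem enorm_sub_sq_le {a b c : ℂ} : ‖a - b‖ₑ ^ 2 ≤ 2 * ‖c - b‖ₑ ^ 2 + 2 * ‖c - a‖ₑ ^ 2 := by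
  have h : ‖a - b‖ ^ 2 ≤ 2 * ‖c - b‖ ^ 2 + 2 * ‖c - a‖ ^ 2 := by
    have h1 : ‖a - b‖ ≤ ‖c - b‖ + ‖c - a‖ := by
      have := norm_sub_le (c - b) (c - a)
      simpa using this
    have h2 : ‖a - b‖ ^ 2 ≤ (‖c - b‖ + ‖c - a‖) ^ 2 := by gcongr
    nlinarith [sq_nonneg (‖c - b‖ - ‖c - a‖)]
  have h3 := ENNReal.ofReal_le_ofReal h
  rw [ENNReal.ofReal_add (by positivity) (by positivity), ENNReal.ofReal_mul (by norm_num),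
    ENNReal.ofReal_mul (by norm_num), ENNReal.ofReal_pow (norm_nonneg _),
    ENNReal.ofReal_pow (norm_nonneg _), ENNReal.ofReal_pow (norm_nonneg _)] at h3
  simpa using h3

/-- Passing from multiplicative to additive differences by averaging over the step. -/
theorem lintegral_additive_difference_le {Ψ : ℝ → ℂ} (hΨ : Measurable Ψ) {X h : ℝ} {J : ℝ≥0∞}
    (hh : 0 < h) (hX : 0 < X) (hhX : h ≤ X)
    (hJ : ∀ l ∈ Set.Ioo 0 (3 * h / X),
      ∫⁻ x in Set.Ioo X (3 * X), ‖Ψ (x + x * l) - Ψ x‖ₑ ^ 2 ≤ J) :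
    ∫⁻ x in Set.Ioo X (2 * X), ‖Ψ (x + h) - Ψ x‖ₑ ^ 2 ≤ 36 * J := by
  set F : ℝ → ℝ → ℝ≥0∞ := fun x v => ‖Ψ (x + v) - Ψ x‖ₑ ^ 2 with hF
  have hFm : Measurable (Function.uncurry F) := by
    simp only [hF, Function.uncurry_def]
    fun_prop
  have hFm1 : ∀ v, Measurable fun x => F x v := fun v => by simp only [hF]; fun_prop
  have hFm2 : ∀ x, Measurable fun v => F x v := fun x => by simp only [hF]; fun_prop
  set M : ℝ≥0∞ := ∫⁻ v in Set.Ioo 0 (3 * h), ∫⁻ x in Set.Ioo X (3 * X), F x v with hM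
  have hinner : Measurable fun v => ∫⁻ x in Set.Ioo X (3 * X), F x v :=
    Measurable.lintegral_prod_left hFm
  -- Compare both points with x + v: the difference of step h is one of step v at x minus one of
  -- step v - h at x + h. As h ≤ X, the point x + h stays in (X, 3X), and both steps lie in (0, 3h).
  -- Averaging over v then bounds h times the left side by 4M.
  have h1 : ∀ v ∈ Set.Ioo (2 * h) (3 * h), ∫⁻ x in Set.Ioo X (2 * X), ‖Ψ (x + h) - Ψ x‖ₑ ^ 2 ≤
      2 * (∫⁻ x in Set.Ioo X (3 * X), F x v) +
        2 * ∫⁻ x in Set.Ioo X (3 * X), F x (v + -h) := by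
    intro v hv
    have hm : Measurable fun x => F (x + h) (v + -h) := (hFm1 _).comp (measurable_add_const h)
    calc _ ≤ ∫⁻ x in Set.Ioo X (2 * X), (2 * F x v + 2 * F (x + h) (v + -h)) := by
          refine lintegral_mono fun x => ?_
          have := enorm_sub_sq_le (a := Ψ (x + h)) (b := Ψ x) (c := Ψ (x + v))
          simp only [hF]
          convert! this using 5
          ring_nf
      _ = 2 * (∫⁻ x in Set.Ioo X (2 * X), F x v) +
          2 * ∫⁻ x in Set.Ioo X (2 * X), F (x + h) (v + -h) := by
          rw [lintegral_add_left ((hFm1 v).const_mul 2), lintegral_const_mul _ (hFm1 v),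
            lintegral_const_mul _ hm]
      _ ≤ _ := by
          refine add_le_add (mul_le_mul' le_rfl ?_) (mul_le_mul' le_rfl ?_)
          · exact lintegral_mono_set (Set.Ioo_subset_Ioo le_rfl (by linarith))
          · have e1 := (measurePreserving_add_right volume h).setLIntegral_comp_preimage
              (s := Set.Ioo (X + h) (2 * X + h)) measurableSet_Ioo (hFm1 (v + -h))
            rw [Set.preimage_add_const_Ioo, add_sub_cancel_right, add_sub_cancel_right] at e1
            rw [e1]
            refine lintegral_mono_set (Set.Ioo_subset_Ioo ?_ ?_) <;> linarith
  have h2 : ENNReal.ofReal h * ∫⁻ x in Set.Ioo X (2 * X), ‖Ψ (x + h) - Ψ x‖ₑ ^ 2 ≤ 4 * M := by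
    have e0 : ENNReal.ofReal h * ∫⁻ x in Set.Ioo X (2 * X), ‖Ψ (x + h) - Ψ x‖ₑ ^ 2 =
        ∫⁻ _ in Set.Ioo (2 * h) (3 * h),
          ∫⁻ x in Set.Ioo X (2 * X), ‖Ψ (x + h) - Ψ x‖ₑ ^ 2 := by
      rw [setLIntegral_const, Real.volume_Ioo, mul_comm]
      congr 2
      ring
    rw [e0]
    refine (setLIntegral_mono' measurableSet_Ioo h1).trans ?_
    have hinner' : Measurable fun v => ∫⁻ x in Set.Ioo X (3 * X), F x (v + -h) :=
      hinner.comp (measurable_add_const (-h))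
    rw [lintegral_add_left (hinner.const_mul 2), lintegral_const_mul _ hinner,
      lintegral_const_mul _ hinner']
    have e1 := (measurePreserving_add_right volume (-h)).setLIntegral_comp_preimage
      (s := Set.Ioo h (2 * h)) measurableSet_Ioo hinner
    rw [Set.preimage_add_const_Ioo, sub_neg_eq_add, sub_neg_eq_add] at e1
    have e2 : Set.Ioo (2 * h) (3 * h) = Set.Ioo (h + h) (2 * h + h) := by
      congr 1 <;> ring
    calc _ ≤ 2 * M + 2 * M := by
          refine add_le_add (mul_le_mul' le_rfl ?_) (mul_le_mul' le_rfl ?_)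
          · exact lintegral_mono_set (Set.Ioo_subset_Ioo (by linarith) le_rfl)
          · rw [e2, e1]
            exact lintegral_mono_set (Set.Ioo_subset_Ioo hh.le (by linarith))
      _ = 4 * M := by rw [← add_mul]; norm_num
  -- Swap the integrals and substitute v = xl for fixed x. The Jacobian is at most 3X, and x > X
  -- forces l < 3h/X, so M ≤ 9hJ; with the previous factor 4 this gives 36.
  have h3 : M ≤ ENNReal.ofReal (3 * X) * (J * ENNReal.ofReal (3 * h / X)) := by
    have hm3 : Measurable (Function.uncurry fun v x => F x v) := by
      simp only [hF, Function.uncurry_def]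
      fun_prop
    rw [hM, lintegral_lintegral_swap hm3.aemeasurable]
    have e1 : ∀ x ∈ Set.Ioo X (3 * X), ∫⁻ v in Set.Ioo 0 (3 * h), F x v ≤
        ENNReal.ofReal (3 * X) * ∫⁻ l in Set.Ioo 0 (3 * h / X), F x (x * l) := by
      intro x hx
      have hx0 : 0 < x := hX.trans hx.1
      have e2 := lintegral_comp_mul_left_of_pos hx0
        (f := (Set.Ioo 0 (3 * h)).indicator (F x)) ((hFm2 x).indicator measurableSet_Ioo)
      rw [lintegral_indicator measurableSet_Ioo] at e2
      have e3 : ∫⁻ v in Set.Ioo 0 (3 * h), F x v = ENNReal.ofReal x *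
          ∫⁻ l, (Set.Ioo 0 (3 * h)).indicator (F x) (x * l) := by
        rw [e2, ← mul_assoc, ← ENNReal.ofReal_mul hx0.le, mul_inv_cancel₀ hx0.ne',
          ENNReal.ofReal_one, one_mul]
      rw [e3]
      refine mul_le_mul' (ENNReal.ofReal_le_ofReal hx.2.le) ?_
      · rw [← lintegral_indicator measurableSet_Ioo]
        refine lintegral_mono fun l => ?_
        by_cases hl : x * l ∈ Set.Ioo 0 (3 * h)
        · have hl0 : 0 < l := (mul_pos_iff_of_pos_left hx0).1 hl.1
          have hl1 : l < 3 * h / X := by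
            rw [lt_div_iff₀ hX]
            have := hl.2
            nlinarith [hx.1]
          rw [Set.indicator_of_mem hl, Set.indicator_of_mem (Set.mem_Ioo.2 ⟨hl0, hl1⟩)]
        · rw [Set.indicator_of_notMem hl]
          exact zero_le
    have hm2 : Measurable (Function.uncurry fun x l => F x (x * l)) := by
      simp only [hF, Function.uncurry_def]
      fun_prop
    refine (setLIntegral_mono' measurableSet_Ioo e1).trans ?_
    rw [lintegral_const_mul' _ _ ENNReal.ofReal_ne_top, lintegral_lintegral_swap hm2.aemeasurable]
    gcongr
    refine (setLIntegral_mono' measurableSet_Ioo hJ).trans (le_of_eq ?_)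
    rw [setLIntegral_const, Real.volume_Ioo, sub_zero]
  have hofh : ENNReal.ofReal h ≠ 0 := by simpa using hh
  refine (ENNReal.mul_le_mul_iff_right hofh ENNReal.ofReal_ne_top).1 ?_
  calc _ ≤ 4 * (ENNReal.ofReal (3 * X) * (J * ENNReal.ofReal (3 * h / X))) := by
        refine h2.trans ?_
        gcongr
    _ = 4 * J * (ENNReal.ofReal (3 * X) * ENNReal.ofReal (3 * h / X)) := by ring
    _ = ENNReal.ofReal h * (36 * J) := by
        rw [← ENNReal.ofReal_mul (by positivity)]
        have : 3 * X * (3 * h / X) = 9 * h := by field_simp; norm_num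
        rw [this, ENNReal.ofReal_mul (by norm_num)]
        have : ENNReal.ofReal 9 = 9 := by simp
        rw [this]
        ring

/-- The mean square over short intervals, from a mean value bound on the line `Re s = σ`. -/
theorem mean_square_of_moment (k : ℕ) {σ A η : ℝ} (hσ : 1 / 2 ≤ σ) (hσ1 : σ ≠ 1) (hA : 0 ≤ A)
    (hη0 : 0 < η) (hη : η < 1)
    (hZ : ∀ τ : ℝ, 1 ≤ τ → ∫⁻ t in Set.Ioo (-τ) τ,
      ENNReal.ofReal (‖riemannZeta (σ + t * Complex.I)‖ ^ (2 * k)) ≤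
        ENNReal.ofReal (A * τ ^ (1 + η))) :
    ∃ K : ℝ, 0 ≤ K ∧ ∀ X h : ℝ, 1 ≤ h → h ≤ X / 8 →
      IntervalIntegrable (fun x : ℝ => (Delta k (x + h) - Delta k x) ^ 2) volume X (2 * X) ∧
      1 / X * ∫ x in X..(2 * X), (Delta k (x + h) - Delta k x) ^ 2
        ≤ K * (h * X ^ (2 * σ - 1 + η)) := by
  obtain ⟨C, hC0, hC⟩ := lintegral_logDelta_shift_le k (by linarith) hσ1 hA hη0 hη hZ
  -- 36 comes from the averaging, 3^{2σ+1} from the weight on (X, 3X), and 3^{1-η} from the largest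
  -- step 3h/X.
  refine ⟨36 * (3 ^ (2 * σ + 1) * C * 3 ^ (1 - η)), by positivity, fun X h hh hhX => ?_⟩
  have hX8 : 8 ≤ X := by linarith
  have hX0 : 0 < X := by linarith
  have hh0 : 0 < h := by linarith
  set Ψ : ℝ → ℂ := fun x => logDelta k (Real.log x) with hΨ
  have hΨm : Measurable Ψ := (measurable_logDelta k).comp Real.measurable_log
  have hquot : 3 * h / X ≤ 1 := by rw [div_le_one hX0]; linarith
  have hJ : ∀ l ∈ Set.Ioo 0 (3 * h / X),
      ∫⁻ x in Set.Ioo X (3 * X), ‖Ψ (x + x * l) - Ψ x‖ₑ ^ 2 ≤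
        ENNReal.ofReal ((3 * X) ^ (2 * σ + 1) * (C * (3 * h / X) ^ (1 - η))) := by
    intro l hl
    have hl0 : 0 < l := hl.1
    set θ : ℝ := Real.log (1 + l) with hθ
    have hθ0 : 0 < θ := Real.log_pos (by linarith)
    have hθl : θ ≤ l := by
      have := Real.log_le_sub_one_of_pos (x := 1 + l) (by linarith)
      linarith
    have hθ1 : θ ≤ 1 := hθl.trans (hl.2.le.trans hquot)
    have himage : Set.Ioo X (3 * X) = Real.exp '' Set.Ioo (Real.log X) (Real.log (3 * X)) := by
      ext x
      constructor
      · intro hx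
        have hx0 : 0 < x := hX0.trans hx.1
        exact ⟨Real.log x, ⟨Real.log_lt_log hX0 hx.1, Real.log_lt_log hx0 hx.2⟩,
          Real.exp_log hx0⟩
      · rintro ⟨u, hu, rfl⟩
        exact ⟨(Real.log_lt_iff_lt_exp hX0).1 hu.1, (Real.lt_log_iff_exp_lt (by linarith)).1 hu.2⟩
    rw [himage, lintegral_image_eq_lintegral_abs_deriv_mul measurableSet_Ioo
      (fun x _ => (Real.hasDerivAt_exp x).hasDerivWithinAt) Real.exp_injective.injOn]
    calc _ ≤ ∫⁻ u in Set.Ioo (Real.log X) (Real.log (3 * X)),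
          ENNReal.ofReal ((3 * X) ^ (2 * σ + 1)) *
          ‖(logDelta k (u + θ) - logDelta k u) * Complex.exp (-(σ * u))‖ₑ ^ 2 := by
          refine setLIntegral_mono' measurableSet_Ioo fun u hu => ?_
          have e1 : Real.log (Real.exp u + Real.exp u * l) = u + θ := by
            rw [show Real.exp u + Real.exp u * l = Real.exp u * (1 + l) by ring,
              Real.log_mul (Real.exp_pos u).ne' (by linarith), Real.log_exp]
          simp only [hΨ, e1, Real.log_exp, Real.abs_exp]
          rw [enorm_mul, mul_pow, mul_comm (‖logDelta k (u + θ) - logDelta k u‖ₑ ^ 2), ← mul_assoc]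
          gcongr
          rw [← ofReal_norm, Complex.norm_exp, ← ENNReal.ofReal_pow (by positivity),
            ← ENNReal.ofReal_mul (by positivity)]
          refine ENNReal.ofReal_le_ofReal ?_
          have e2 : Real.exp u ≤ 3 * X :=
            ((Real.lt_log_iff_exp_lt (by linarith)).1 hu.2).le
          -- The Jacobian e^u of x = e^u is traded for the Plancherel weight e^{-2σu} at the price
          -- of (3X)^{2σ+1}.
          calc Real.exp u = Real.exp u ^ (2 * σ + 1) * Real.exp (-(σ * u)) ^ 2 := by
                rw [← Real.exp_mul, ← Real.exp_nat_mul, ← Real.exp_add]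
                congr 1
                push_cast
                ring
            _ ≤ (3 * X) ^ (2 * σ + 1) * Real.exp (-(σ * u)) ^ 2 := by gcongr
            _ = _ := by simp
      _ ≤ ENNReal.ofReal ((3 * X) ^ (2 * σ + 1)) * ∫⁻ u : ℝ,
          ‖(logDelta k (u + θ) - logDelta k u) * Complex.exp (-(σ * u))‖ₑ ^ 2 := by
          rw [lintegral_const_mul' _ _ ENNReal.ofReal_ne_top]
          gcongr
          exact Measure.restrict_le_self
      _ ≤ ENNReal.ofReal ((3 * X) ^ (2 * σ + 1)) *
          ENNReal.ofReal (C * (3 * h / X) ^ (1 - η)) := by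
          gcongr
          refine (hC θ hθ0 hθ1).trans (ENNReal.ofReal_le_ofReal ?_)
          gcongr
          exact hθl.trans hl.2.le
      _ = _ := by rw [← ENNReal.ofReal_mul (by positivity)]
  have hI := lintegral_additive_difference_le hΨm hh0 hX0 (by linarith) hJ
  set V : ℝ := 36 * ((3 * X) ^ (2 * σ + 1) * (C * (3 * h / X) ^ (1 - η))) with hV
  have hV0 : 0 ≤ V := by positivity
  have hre : ∀ x : ℝ, 1 < x → Delta k x = (Ψ x).re := by
    intro x hx
    simp only [hΨ, logDelta, Set.indicator_of_mem (Set.mem_Ioi.2 (Real.log_pos hx)),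
      Real.exp_log (zero_lt_one.trans hx)]
    simp [Delta, divisorSum]
  have hle : X ≤ 2 * X := by linarith
  have hmeas : AEStronglyMeasurable (fun x : ℝ => (Delta k (x + h) - Delta k x) ^ 2)
      (volume.restrict (Set.Ioo X (2 * X))) := by
    have e1 : Measurable fun x => ((Ψ (x + h)).re - (Ψ x).re) ^ 2 := by fun_prop
    refine e1.aestronglyMeasurable.congr ?_
    refine (ae_restrict_iff' measurableSet_Ioo).2 (.of_forall fun x hx => ?_)
    simp only
    rw [hre x (by linarith [hx.1]), hre (x + h) (by linarith [hx.1])]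
  have hlin : ∫⁻ x in Set.Ioo X (2 * X),
      ENNReal.ofReal ((Delta k (x + h) - Delta k x) ^ 2) ≤ ENNReal.ofReal V := by
    calc _ ≤ ∫⁻ x in Set.Ioo X (2 * X), ‖Ψ (x + h) - Ψ x‖ₑ ^ 2 := by
          refine setLIntegral_mono' measurableSet_Ioo fun x hx => ?_
          rw [← ofReal_norm, ← ENNReal.ofReal_pow (norm_nonneg _)]
          refine ENNReal.ofReal_le_ofReal ?_
          rw [← sq_abs]
          gcongr
          exact norm_logDelta_log (by linarith [hx.1]) (by linarith [hx.1])
      _ ≤ _ := hI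
      _ = ENNReal.ofReal V := by
          rw [hV, ENNReal.ofReal_mul (by norm_num : (0 : ℝ) ≤ 36), ENNReal.ofReal_ofNat]
  have hint : IntegrableOn (fun x : ℝ => (Delta k (x + h) - Delta k x) ^ 2)
      (Set.Ioo X (2 * X)) := by
    refine ⟨hmeas, ?_⟩
    rw [hasFiniteIntegral_iff_ofReal (.of_forall fun x => sq_nonneg _)]
    exact hlin.trans_lt ENNReal.ofReal_lt_top
  refine ⟨(intervalIntegrable_iff_integrableOn_Ioo_of_le hle).2 hint, ?_⟩
  have hval : ∫ x in X..(2 * X), (Delta k (x + h) - Delta k x) ^ 2 ≤ V := by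
    rw [intervalIntegral.integral_of_le hle, integral_Ioc_eq_integral_Ioo,
      integral_eq_lintegral_of_nonneg_ae (.of_forall fun x => sq_nonneg _) hmeas]
    exact ENNReal.toReal_le_of_le_ofReal hV0 hlin
  calc 1 / X * ∫ x in X..(2 * X), (Delta k (x + h) - Delta k x) ^ 2 ≤ 1 / X * V := by gcongr
    _ = 36 * (3 ^ (2 * σ + 1) * C * 3 ^ (1 - η)) * (h ^ (1 - η) * X ^ (2 * σ - 1 + η)) := by
        have e1 : X ^ (2 * σ + 1) = X ^ (2 * σ - 1 + η) * X ^ (1 - η) * X := by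
          nth_rewrite 4 [← Real.rpow_one X]
          rw [← Real.rpow_add hX0, ← Real.rpow_add hX0]
          congr 1
          ring
        have e2 : X ^ (1 - η) ≠ 0 := (Real.rpow_pos_of_pos hX0 _).ne'
        rw [hV, Real.mul_rpow (by norm_num) hX0.le, Real.div_rpow (by positivity) hX0.le,
          Real.mul_rpow (by norm_num) hh0.le, e1]
        field_simp
    _ ≤ _ := by
        gcongr
        conv_rhs => rw [← Real.rpow_one h]
        exact Real.rpow_le_rpow_of_exponent_le hh (by linarith)

/-! ### The moment hypothesis, and uniformity in δ -/

/-- Conjugation symmetry handles t < 0. Below the threshold S, monotonicity in τ replaces the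
integral by the one at S, at the cost of S^{1+η}. So the constant depends on the threshold for this
δ and not only on `C η`; uniformity has to be recovered later. -/
theorem ZetaMomentBound.exists_lintegral_le {k : ℕ} {δ : ℝ} {C : ℝ → ℝ}
    (h : ZetaMomentBound k δ C) {η : ℝ} (hη : 0 < η) :
    ∃ A : ℝ, 0 ≤ A ∧ ∀ τ : ℝ, 1 ≤ τ → ∫⁻ t in Set.Ioo (-τ) τ,
      ENNReal.ofReal (‖riemannZeta ((1 / 2 + δ : ℝ) + t * Complex.I)‖ ^ (2 * k)) ≤
        ENNReal.ofReal (A * τ ^ (1 + η)) := by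
  set f : ℝ → ℝ := fun t => ‖riemannZeta ((1 / 2 + δ : ℝ) + t * Complex.I)‖ ^ (2 * k) with hf
  have hf0 : ∀ t, 0 ≤ f t := fun t => by positivity
  have heven : ∀ t, f (-t) = f t := by
    intro t
    simp only [hf]
    have : ((1 / 2 + δ : ℝ) : ℂ) + (-t : ℝ) * Complex.I =
        (starRingEnd ℂ) ((1 / 2 + δ : ℝ) + t * Complex.I) := by
      simp only [map_add, map_mul, Complex.conj_ofReal, Complex.conj_I]
      push_cast
      ring
    rw [this, riemannZeta_conj, RCLike.norm_conj]
  obtain ⟨T, hT⟩ := eventually_atTop.1 (h η hη)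
  set S : ℝ := max T 1 with hS
  have hS1 : 1 ≤ S := le_max_right _ _
  have hbig : ∀ τ : ℝ, S ≤ τ → ∫⁻ t in Set.Icc 0 τ, ENNReal.ofReal (f t) ≤
      ENNReal.ofReal (|C η| * τ ^ (1 + η)) := by
    intro τ hτ
    have hτ0 : 0 ≤ τ := by linarith
    obtain ⟨h1, h2⟩ := hT τ ((le_max_left _ _).trans hτ)
    have e : (fun t : ℝ => ‖riemannZeta (1 / 2 + δ + t * Complex.I)‖ ^ (2 * k)) = f := by
      ext t
      simp only [hf]
      push_cast
      rfl
    rw [e] at h1 h2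
    rw [← setLIntegral_congr Ioc_ae_eq_Icc, ← ofReal_integral_eq_lintegral_ofReal
      ((intervalIntegrable_iff_integrableOn_Ioc_of_le hτ0).1 h1) (.of_forall hf0),
      ← intervalIntegral.integral_of_le hτ0]
    refine ENNReal.ofReal_le_ofReal (h2.trans ?_)
    gcongr
    exact le_abs_self _
  have hall : ∀ τ : ℝ, 1 ≤ τ → ∫⁻ t in Set.Icc 0 τ, ENNReal.ofReal (f t) ≤
      ENNReal.ofReal (|C η| * S ^ (1 + η) * τ ^ (1 + η)) := by
    intro τ hτ
    have e1 : (1 : ℝ) ≤ S ^ (1 + η) := Real.one_le_rpow hS1 (by linarith)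
    have e2 : (1 : ℝ) ≤ τ ^ (1 + η) := Real.one_le_rpow hτ (by linarith)
    rcases le_total S τ with hle | hle
    · refine (hbig τ hle).trans (ENNReal.ofReal_le_ofReal ?_)
      gcongr
      exact le_mul_of_one_le_right (abs_nonneg _) e1
    · refine (lintegral_mono_set (Set.Icc_subset_Icc le_rfl hle)).trans ((hbig S le_rfl).trans
        (ENNReal.ofReal_le_ofReal ?_))
      exact le_mul_of_one_le_right (by positivity) e2
  refine ⟨2 * (|C η| * S ^ (1 + η)), by positivity, fun τ hτ => ?_⟩
  have hsub : Set.Ioo (-τ) τ ⊆ Set.Icc 0 τ ∪ Neg.neg ⁻¹' Set.Icc 0 τ := by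
    intro t ht
    rcases le_total 0 t with h0 | h0
    · exact Or.inl ⟨h0, ht.2.le⟩
    · refine Or.inr ⟨?_, ?_⟩
      · linarith
      · linarith [ht.1]
  have hneg : ∫⁻ t in Neg.neg ⁻¹' Set.Icc 0 τ, ENNReal.ofReal (f t) =
      ∫⁻ t in Set.Icc 0 τ, ENNReal.ofReal (f t) := by
    have := (Measure.measurePreserving_neg (volume : Measure ℝ)).setLIntegral_comp_preimage_emb
      (MeasurableEquiv.neg ℝ).measurableEmbedding (fun t => ENNReal.ofReal (f t)) (Set.Icc 0 τ)
    rw [← this]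
    simp only [heven]
  calc _ ≤ ∫⁻ t in Set.Icc 0 τ ∪ Neg.neg ⁻¹' Set.Icc 0 τ, ENNReal.ofReal (f t) :=
        lintegral_mono_set hsub
    _ ≤ (∫⁻ t in Set.Icc 0 τ, ENNReal.ofReal (f t)) +
        ∫⁻ t in Neg.neg ⁻¹' Set.Icc 0 τ, ENNReal.ofReal (f t) := lintegral_union_le _ _ _
    _ ≤ ENNReal.ofReal (|C η| * S ^ (1 + η) * τ ^ (1 + η)) +
        ENNReal.ofReal (|C η| * S ^ (1 + η) * τ ^ (1 + η)) := by
        rw [hneg]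
        exact add_le_add (hall τ hτ) (hall τ hτ)
    _ = _ := by
        rw [← ENNReal.ofReal_add (by positivity) (by positivity)]
        congr 1
        ring

theorem exists_norm_riemannZeta_le {σ : ℝ} (hσ : 1 < σ) :
    ∃ M : ℝ, 0 ≤ M ∧ ∀ t : ℝ, ‖riemannZeta (σ + t * Complex.I)‖ ≤ M := by
  have hsum : Summable fun n : ℕ => ‖LSeries.term 1 σ n‖ :=
    (LSeriesHasSum_one (s := σ) (by simpa using hσ)).LSeriesSummable.norm
  refine ⟨∑' n : ℕ, ‖LSeries.term 1 σ n‖, tsum_nonneg fun _ => norm_nonneg _, fun t => ?_⟩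
  have hnorm : ∀ n : ℕ, ‖LSeries.term 1 (σ + t * Complex.I) n‖ = ‖LSeries.term 1 σ n‖ := by
    intro n
    rw [LSeries.norm_term_eq, LSeries.norm_term_eq]
    simp
  rw [← LSeries_one_eq_riemannZeta (s := σ + t * Complex.I) (by simpa using hσ), LSeries]
  simp only [← hnorm] at hsum ⊢
  exact norm_tsum_le_tsum_norm hsum

/-- Right of the line Re s = 1, ζ is bounded on vertical lines. This unconditional case later covers
every δ ≥ 1/2, including the line through the pole. -/
theorem exists_zetaMomentBound (k : ℕ) {δ : ℝ} (hδ : 1 / 2 < δ) :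
    ∃ C : ℝ → ℝ, ZetaMomentBound k δ C := by
  obtain ⟨M, hM0, hM⟩ := exists_norm_riemannZeta_le (σ := 1 / 2 + δ) (by linarith)
  push_cast at hM
  refine ⟨fun _ => M ^ (2 * k), fun η hη => ?_⟩
  filter_upwards [eventually_ge_atTop 1] with τ hτ
  have hcont : Continuous fun t : ℝ => ‖riemannZeta (1 / 2 + δ + t * Complex.I)‖ ^ (2 * k) := by
    rw [continuous_iff_continuousAt]
    intro t
    refine (ContinuousAt.norm ?_).pow _
    refine ContinuousAt.comp (g := riemannZeta) (differentiableAt_riemannZeta ?_).continuousAt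
      (by fun_prop)
    intro h
    have := congrArg Complex.re h
    simp at this
    linarith
  refine ⟨hcont.intervalIntegrable _ _, ?_⟩
  calc ∫ t in (0 : ℝ)..τ, ‖riemannZeta (1 / 2 + δ + t * Complex.I)‖ ^ (2 * k)
      ≤ ∫ t in (0 : ℝ)..τ, M ^ (2 * k) := by
        refine intervalIntegral.integral_mono_on (by linarith) (hcont.intervalIntegrable _ _)
          intervalIntegrable_const fun t _ => ?_
        gcongr
        exact hM t
    _ = M ^ (2 * k) * τ := by simp [mul_comm]
    _ ≤ _ := by
        gcongr
        conv_lhs => rw [← Real.rpow_one τ]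
        exact Real.rpow_le_rpow_of_exponent_le hτ (by linarith)

/-- The theorem for a single exponent `δ`, with a constant depending on `δ`. -/
theorem mean_square_short_intervals (k : ℕ) {δ : ℝ} {C : ℝ → ℝ} (hδ : 0 ≤ δ) (hδ1 : δ ≠ 1 / 2)
    (hC : ZetaMomentBound k δ C) {ε : ℝ} (hε : 0 < ε) :
    ∃ K : ℝ, 0 ≤ K ∧ ∀ X h : ℝ, 1 ≤ h → h ≤ X / 8 →
      IntervalIntegrable (fun x : ℝ => (Delta k (x + h) - Delta k x) ^ 2) volume X (2 * X) ∧
      1 / X * ∫ x in X..(2 * X), (Delta k (x + h) - Delta k x) ^ 2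
        ≤ K * (h * X ^ (2 * δ + ε)) := by
  -- The cap 1/2 keeps η < 1, as the partial summation requires.
  have hη0 : 0 < min ε (1 / 2) := lt_min hε (by norm_num)
  have hη1 : min ε (1 / 2) < 1 := (min_le_right _ _).trans_lt (by norm_num)
  obtain ⟨A, hA0, hA⟩ := hC.exists_lintegral_le hη0
  obtain ⟨K, hK0, hK⟩ := mean_square_of_moment k (σ := 1 / 2 + δ) (by linarith)
    (fun h => hδ1 (by linarith)) hA0 hη0 hη1 hA
  refine ⟨K, hK0, fun X h hh hX => ⟨(hK X h hh hX).1, (hK X h hh hX).2.trans ?_⟩⟩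
  have : min ε (1 / 2) ≤ ε := min_le_left _ _
  gcongr
  · linarith
  · linarith

/-- The bound for a fixed exponent δ' has a constant depending on δ', so δ' must be chosen from k, ε
and `C` alone. The bound for δ' with ε/2 implies the one for δ with ε whenever δ' ≤ δ + ε/4, and
finitely many choices of δ' suffice. -/
theorem theorem4 (k : ℕ) (hk : 3 ≤ k) (C : ℝ → ℝ) (ε : ℝ) (hε : 0 < ε) :
    ∃ K : ℝ, ∀ δ : ℝ, 0 ≤ δ → ZetaMomentBound k δ C →
      ∀ X h : ℝ, 1 ≤ h → h ≤ X / 8 →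
        IntervalIntegrable (fun x : ℝ => (Delta k (x + h) - Delta k x) ^ 2)
          MeasureTheory.volume X (2 * X) ∧
        1 / X * ∫ x in X..(2 * X), (Delta k (x + h) - Delta k x) ^ 2
          ≤ K * (h * X ^ (2 * δ + ε)) := by
  -- With δ' = 1/2 + ε/4 and ε/2 in place of ε, the exponent is 1 + ε, which is at most 2δ + ε once
  -- δ ≥ 1/2. The same instance supplies integrability for every δ.
  obtain ⟨C', hC'⟩ := exists_zetaMomentBound k (δ := 1 / 2 + ε / 4) (by linarith)
  obtain ⟨K₀, hK₀0, hK₀⟩ := mean_square_short_intervals k (by linarith)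
    (fun h => by linarith) hC' (half_pos hε)
  -- one constant for each of the finitely many intervals `[j ε / 4, (j + 1) ε / 4)`
  have hcell : ∀ j : ℕ, ∃ K : ℝ, 0 ≤ K ∧ ∀ δ : ℝ, 0 ≤ δ → δ < 1 / 2 → ZetaMomentBound k δ C →
      ⌊δ / (ε / 4)⌋₊ = j → ∀ X h : ℝ, 1 ≤ h → h ≤ X / 8 →
        1 / X * ∫ x in X..(2 * X), (Delta k (x + h) - Delta k x) ^ 2
          ≤ K * (h * X ^ (2 * δ + ε)) := by
    intro j
    -- If the cell contains an admissible exponent, one is fixed before δ is given. Otherwise no δ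
    -- in the cell satisfies the hypothesis and any constant works.
    by_cases hex : ∃ δ : ℝ, 0 ≤ δ ∧ δ < 1 / 2 ∧ ZetaMomentBound k δ C ∧ ⌊δ / (ε / 4)⌋₊ = j
    · obtain ⟨δ', h0', h1', hM', hj'⟩ := hex
      obtain ⟨K, hK0, hK⟩ := mean_square_short_intervals k h0' h1'.ne hM' (half_pos hε)
      refine ⟨K, hK0, fun δ h0 _ _ hj X h hh hX => (hK X h hh hX).2.trans ?_⟩
      have hε4 : 0 < ε / 4 := by linarith
      have hlo : (j : ℝ) * (ε / 4) ≤ δ := by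
        rw [← le_div_iff₀ hε4, ← hj]
        exact Nat.floor_le (by positivity)
      have hhi : δ' < (j + 1 : ℝ) * (ε / 4) := by
        rw [← div_lt_iff₀ hε4, ← hj']
        exact Nat.lt_floor_add_one _
      gcongr K * (h * X ^ ?_)
      · linarith
      · linarith
    · refine ⟨0, le_rfl, fun δ h0 h1 hM hj => (hex ⟨δ, h0, h1, hM, hj⟩).elim⟩
  choose K hK0 hK using hcell
  -- Index of the cell containing 1/2. Every δ < 1/2 lies in a cell of index at most N, so the sum
  -- of the cell constants dominates each of them.
  set N : ℕ := ⌊1 / 2 / (ε / 4)⌋₊ with hN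
  refine ⟨K₀ + ∑ j ∈ Finset.range (N + 1), K j, fun δ hδ hM X h hh hX =>
    ⟨(hK₀ X h hh hX).1, ?_⟩⟩
  have hX1 : 1 ≤ X := by linarith
  have hsum0 : 0 ≤ ∑ j ∈ Finset.range (N + 1), K j := Finset.sum_nonneg fun j _ => hK0 j
  rcases lt_or_ge δ (1 / 2) with hlt | hge
  · refine (hK _ δ hδ hlt hM rfl X h hh hX).trans ?_
    gcongr
    have hmem : ⌊δ / (ε / 4)⌋₊ ∈ Finset.range (N + 1) := by
      rw [Finset.mem_range, Nat.lt_succ_iff]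
      exact Nat.floor_le_floor (by gcongr)
    have := Finset.single_le_sum (fun j _ => hK0 j) hmem
    linarith
  · refine (hK₀ X h hh hX).2.trans ?_
    gcongr ?_ * (h * X ^ ?_)
    · linarith
    · linarith
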